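/- **Setting.** A rod on $[0,1]$ is actuated at $0=\xi_1<\dots<\xi_m=1$ with weights $\beta_k\ge 0$ and sensed at $0\le\zeta_1<\dots<\zeta_p\le1$. States lie in $L^2(0,1)$ (complex). For an input $u=(u_1,\dots,u_m)$ the rod is $$\frac{\partial z}{\partial t}=\frac{\partial^2 z}{\partial x^2},\qquad z \text{ continuous},\qquad \frac{\partial z}{\partial x}(\xi_k^-,t)-\frac{\partial z}{\partial x}(\xi_k^+,t)=\beta_k u_k(t),$$ with the convention $\partial z/\partial x=0$ outside $[0,1]$ (and no other jumps of $\partial z/\partial x$). Let $K_1,\dots,K_m$ be real continuous functions on $[0,1]$ and $a_i,b_i$ $(1\le i\le p)$ real numbers. The *closed loop* $A_K$ is the operator of the rod with $u=\int_0^1K(x)z(x)\,dx$. The *combined system* $\mathcal A$ (noise-free) consists of the rod with $u=\int_0^1K(x)\hat z(x,t)\,dx$ together with the filter: a copy of the rod with the same input $u$, driven by the error $\tilde z=z-\hat z$ at the sensors, $$\frac{\partial\hat z}{\partial t}=\frac{\partial^2\hat z}{\partial x^2}+\sum_{i=1}^p\bigl(a_i+b_i\,\delta(x-\zeta_i)\bigr)\tilde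 z(\zeta_i,t).$$ The *error dynamics* $A_F$ is $$\frac{\partial\tilde z}{\partial t}=\frac{\partial^2\tilde z}{\partial x^2}-\sum_{i=1}^p\bigl(a_i+b_i\,\delta(x-\zeta_i)\bigr)\tilde z(\zeta_i,t)$$ with Neumann boundary conditions. Dirac terms mean jumps of the $x$-derivative, at an endpoint with the convention above; e.g. $\tilde z_x(\zeta_i^+)-\tilde z_x(\zeta_i^-)=b_i\tilde z(\zeta_i)$. **Theorem.** For all such $K,a,b$: 1. In the coordinates $(z,\tilde z)$ the combined dynamics is block upper triangular: $(z,\tilde z)$ is in its domain with image $(f,g)$ if and only if $A_F\tilde z=g$ (which does not involve $z$) and $f$ is the right-hand side of the rod at $z$ with input $u=\int_0^1K(x)(z(x)-\tilde z(x))\,dx$. When $\tilde z=0$ the dynamics of $z$ is exactly $A_K$. 2. $\sigma(\mathcal A)=\sigma(A_K)\cup\sigma(A_F)$, and the combined operator in the coordinates $(z,\tilde z)$ has the same spectrum. 3. If $\sigma(A_K)$ and $\sigma(A_F)$ lie in the open left half plane, then the combined system is asymptotically stable in $L^2\times L^2$: every initial state has a trajectory (continuous on $[0,\infty)$, differentiable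 and in the domain for $t>0$), the zero state is Lyapunov stable, and every trajectory tends to $0$. Moreover $z(x,t)\to0$ and $\tilde z(x,t)\to0$ uniformly in $x\in[0,1]$ as $t\to\infty$. In particular this holds for the LQR feedback with state weight $q>0$ and positive definite $m\times m$ control weight $R$, $$K(x)=-R^{-1}\beta\,[P(\xi_1,x),\dots,P(\xi_m,x)]',\qquad P(x_1,x_2)=\sum_{n\ge0}\Bigl(-n^2\pi^2+\sqrt{n^4\pi^4+\gamma_nq}\Bigr)\cos n\pi x_1\cos n\pi x_2,$$ where $\beta=\mathrm{diag}(\beta_1,\dots,\beta_m)$, $\gamma_n=c_n'\beta R^{-1}\beta c_n$, $c_n=[\cos n\pi\xi_1,\dots,\cos n\pi\xi_m]'$, together with the Kalman gains $$L_i=D_i^{-2}\sqrt{\frac{B^2}{\sum_jC_j^2D_j^{-2}}}\;C_i$$ (process noise coefficient $B$, observation coefficients $C_i>0$, measurement noise coefficients $D_i\neq0$), used either as spatially uniform injection ($a=L$, $b=0$) or as point injection ($a=0$, $b=L$). -/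

import Mathlib

open Set Filter Topology MeasureTheory

noncomputable section

namespace HeatRod

/-- The state space of a rod of length one: the complex Hilbert space `L²(0,1)`. -/
abbrev State : Type := Lp ℂ 2 (volume.restrict (Icc (0 : ℝ) 1))

/-- `Z` is a temperature profile, continuous on `[0,1]`, of the state `z`. -/
def Represents (Z : ℝ → ℂ) (z : State) : Prop :=
  ContinuousOn Z (Icc 0 1) ∧ ∀ᵐ x ∂(volume.restrict (Icc (0 : ℝ) 1)), z x = Z x

/-- `Z` is continuous on `[0,1]`, and off finitely many points it has a derivative `dZ` there that is
an indefinite integral of `F` (so `Z'' = F`; `F` is square integrable wherever this is used).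
With the convention `dZ = 0` outside `[0,1]`, the one-sided limits of `dZ` exist at every
`x ∈ [0,1]` and `dZ(x⁻) - dZ(x⁺) = J x`.  For `J = 0` this is the Neumann Laplacian: at the
ends the condition reads `Z'(0⁺) = 0` and `Z'(1⁻) = 0`. -/
def IsProfile (J Z F : ℝ → ℂ) : Prop :=
  ContinuousOn Z (Icc 0 1) ∧
  ∃ (S : Finset ℝ) (dZ : ℝ → ℂ),
    (∀ x ∈ Ioo (0 : ℝ) 1, x ∉ S → HasDerivAt Z (dZ x) x) ∧
    (∀ a b : ℝ, a < b → Icc a b ⊆ Ioo 0 1 \ (S : Set ℝ) → dZ b - dZ a = ∫ x in a..b, F x) ∧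
    (∀ x, x ∉ Icc (0 : ℝ) 1 → dZ x = 0) ∧
    (∀ x ∈ Icc (0 : ℝ) 1, ∃ l r : ℂ,
      Tendsto dZ (𝓝[<] x) (𝓝 l) ∧ Tendsto dZ (𝓝[>] x) (𝓝 r) ∧ l - r = J x)

/-- The flux `g i` placed at the point `η i`, and no flux elsewhere. -/
def pointFlux {n : ℕ} (η : Fin n → ℝ) (g : Fin n → ℂ) (x : ℝ) : ℂ :=
  ∑ i, if x = η i then g i else 0

/-- The (real) feedback functionals `u_k = ∫₀¹ K_k(x) z(x) dx`. -/
def feedback {n : ℕ} (K : Fin n → ℝ → ℝ) (z : State) (k : Fin n) : ℂ :=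
  ∫ x in Icc (0 : ℝ) 1, (K k x : ℂ) * z x

/-! Unbounded operators are given by their graphs: `(w, v) ∈ G` means that `w` is in the domain and
is sent to `v`. -/

/-- The point-controlled rod with input `u`: `f = z''` off the actuators, `z` continuous, and
`z'(ξ_k⁻) - z'(ξ_k⁺) = β_k u_k`. -/
def rod {n : ℕ} (ξ β : Fin n → ℝ) (u : Fin n → ℂ) : Set (State × State) :=
  {zf | ∃ Z, Represents Z zf.1 ∧ IsProfile (pointFlux ξ fun k => (β k : ℂ) * u k) Z zf.2}

/-- The rod under the full state feedback `u = ∫ K z`. -/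
def closedLoop {n : ℕ} (ξ β : Fin n → ℝ) (K : Fin n → ℝ → ℝ) : Set (State × State) :=
  {zf | zf ∈ rod ξ β (feedback K zf.1)}

/-- The error dynamics `f = e'' - ∑ i, a_i e(ζ_i) - ∑ i, b_i δ(x - ζ_i) e(ζ_i)` with Neumann boundary
conditions; the Dirac terms are the jumps `e'(ζ_i⁺) - e'(ζ_i⁻) = b_i e(ζ_i)`. -/
def errorDynamics {p : ℕ} (ζ a b : Fin p → ℝ) : Set (State × State) :=
  {ef | ∃ E, Represents E ef.1 ∧
    IsProfile (pointFlux ζ fun i => -((b i : ℂ) * E (ζ i))) E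
      (fun x => ef.2 x + ∑ i, (a i : ℂ) * E (ζ i))}

/-- The combined system in the coordinates (rod `z`, estimate `ẑ`), without noise.  The rod obeys
`∂z/∂t = z''` with input `u = ∫ K ẑ`; the filter is a copy of it with the same input, driven by the
innovations: `∂ẑ/∂t = ẑ'' + ∑ i, (a_i + b_i δ(x - ζ_i)) (z(ζ_i) - ẑ(ζ_i))`. -/
def lqgSystem {n p : ℕ} (ξ β : Fin n → ℝ) (K : Fin n → ℝ → ℝ) (ζ a b : Fin p → ℝ) :
    Set ((State × State) × (State × State)) :=
  {wv | ∃ Z Y, Represents Z wv.1.1 ∧ Represents Y wv.1.2 ∧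
    IsProfile (pointFlux ξ fun k => (β k : ℂ) * feedback K wv.1.2 k) Z wv.2.1 ∧
    IsProfile
      (fun x => pointFlux ξ (fun k => (β k : ℂ) * feedback K wv.1.2 k) x +
        pointFlux ζ (fun i => (b i : ℂ) * (Z (ζ i) - Y (ζ i))) x)
      Y (fun x => wv.2.2 x - ∑ i, (a i : ℂ) * (Z (ζ i) - Y (ζ i)))}

/-- The same system in the coordinates `(z, e)`, where `e = z - ẑ` is the estimation error. -/
def lqgSystemErr {n p : ℕ} (ξ β : Fin n → ℝ) (K : Fin n → ℝ → ℝ) (ζ a b : Fin p → ℝ) :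
    Set ((State × State) × (State × State)) :=
  {wv | ((wv.1.1, wv.1.1 - wv.1.2), (wv.2.1, wv.2.1 - wv.2.2)) ∈ lqgSystem ξ β K ζ a b}

section Abstract

variable {E : Type*} [NormedAddCommGroup E] [NormedSpace ℂ E]

/-- The spectrum of the operator `A` with graph `G`: those `μ` for which `μ - A` has no bounded
everywhere defined inverse `R`. -/
def spec (G : Set (E × E)) : Set ℂ :=
  {μ | ¬ ∃ R : E →L[ℂ] E, ∀ w g : E, (w, μ • w - g) ∈ G ↔ w = R g}

/-- Trajectories on `[0,∞)` of `du/dt = A u`, where `G` is the graph of `A`. -/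
def IsTrajectory (G : Set (E × E)) (u : ℝ → E) : Prop :=
  ContinuousOn u (Ici 0) ∧ ∀ t > 0, ∃ v, HasDerivAt u v t ∧ (u t, v) ∈ G

/-- Asymptotic stability of `du/dt = A u`: every initial state has a trajectory, the zero state is
Lyapunov stable, and every trajectory tends to it. -/
def AsymptoticallyStable (G : Set (E × E)) : Prop :=
  (∀ w : E, ∃ u, IsTrajectory G u ∧ u 0 = w) ∧
  (∀ ε > 0, ∃ δ > 0, ∀ u, IsTrajectory G u → ‖u 0‖ < δ → ∀ t ≥ 0, ‖u t‖ < ε) ∧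
  (∀ u, IsTrajectory G u → Tendsto u atTop (𝓝 0))

end Abstract

/-- The separation property for feedback kernels `K` and filter gains `a` (spatially uniform
injection) and `b` (point injection). -/
structure SeparationProperty {n p : ℕ} (ξ β : Fin n → ℝ) (K : Fin n → ℝ → ℝ)
    (ζ a b : Fin p → ℝ) : Prop where
  /-- Block upper triangular form: the error obeys its own dynamics, which do not depend on `z`, and
  the rod is driven by the input `∫ K (z - e)`. -/
  triangular : ∀ z e f g : State,
    ((z, e), (f, g)) ∈ lqgSystemErr ξ β K ζ a b ↔
      (e, g) ∈ errorDynamics ζ a b ∧ (z, f) ∈ rod ξ β (feedback K (z - e))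
  /-- For zero error the rod obeys the dynamics under full state feedback. -/
  zero_error : ∀ z f : State,
    ((z, 0), (f, 0)) ∈ lqgSystemErr ξ β K ζ a b ↔ (z, f) ∈ closedLoop ξ β K
  spec_eq : spec (lqgSystem ξ β K ζ a b) = spec (closedLoop ξ β K) ∪ spec (errorDynamics ζ a b)
  spec_err_eq :
    spec (lqgSystemErr ξ β K ζ a b) = spec (closedLoop ξ β K) ∪ spec (errorDynamics ζ a b)
  stable : (∀ μ ∈ spec (closedLoop ξ β K), μ.re < 0) →
    (∀ μ ∈ spec (errorDynamics ζ a b), μ.re < 0) →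
    AsymptoticallyStable (lqgSystem ξ β K ζ a b) ∧
    /- the temperature `z(x,t)` and the error `e(x,t)` tend to zero, uniformly in `x` -/
    ∀ u, IsTrajectory (lqgSystem ξ β K ζ a b) u → ∀ Z E : ℝ → ℝ → ℂ,
      (∀ t > 0, Represents (Z t) (u t).1 ∧ Represents (E t) ((u t).1 - (u t).2)) →
      TendstoUniformlyOn Z 0 atTop (Icc 0 1) ∧ TendstoUniformlyOn E 0 atTop (Icc 0 1)

/-- `γ_n = c' β' R⁻¹ β c` with `c_k = cos (n π ξ_k)` and `β` read as a diagonal matrix. -/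
def gammaCoeff {n : ℕ} (ξ β : Fin n → ℝ) (R : Matrix (Fin n) (Fin n) ℝ) (j : ℕ) : ℝ :=
  ∑ k, ∑ l, (β k * Real.cos (j * Real.pi * ξ k)) * R⁻¹ k l * (β l * Real.cos (j * Real.pi * ξ l))

/-- The nonnegative root of `-2 n² π² P + q = γ_n P²`. -/
def riccatiCoeff {n : ℕ} (ξ β : Fin n → ℝ) (R : Matrix (Fin n) (Fin n) ℝ) (q : ℝ) (j : ℕ) : ℝ :=
  -((j : ℝ) ^ 2 * Real.pi ^ 2) +
    Real.sqrt ((j : ℝ) ^ 4 * Real.pi ^ 4 + gammaCoeff ξ β R j * q)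

/-- The kernel `P(x₁,x₂) = ∑ P_n cos (n π x₁) cos (n π x₂)`. -/
def riccatiKernel {n : ℕ} (ξ β : Fin n → ℝ) (R : Matrix (Fin n) (Fin n) ℝ) (q : ℝ)
    (x₁ x₂ : ℝ) : ℝ :=
  ∑' j : ℕ, riccatiCoeff ξ β R q j * Real.cos (j * Real.pi * x₁) * Real.cos (j * Real.pi * x₂)

/-- The LQR gain `K(x) = -R⁻¹ β [P(ξ_1,x), …, P(ξ_m,x)]'`. -/
def lqrGain {n : ℕ} (ξ β : Fin n → ℝ) (R : Matrix (Fin n) (Fin n) ℝ) (q : ℝ)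
    (k : Fin n) (x : ℝ) : ℝ :=
  -∑ l, R⁻¹ k l * (β l * riccatiKernel ξ β R q (ξ l) x)

/-- The Kalman gain `L_i = D_i⁻² P C_i`, where `P² = B² / ∑ C_i² D_i⁻²`. -/
def kalmanGain {p : ℕ} (B : ℝ) (C D : Fin p → ℝ) (i : Fin p) : ℝ :=
  (D i ^ 2)⁻¹ * Real.sqrt (B ^ 2 / ∑ j, C j ^ 2 * (D j ^ 2)⁻¹) * C i

end HeatRod

end

/-!
The combined system is block upper triangular in the coordinates `(z, e)`, `e = z - ẑ`: subtracting the
filter from the rod cancels the common input (`mem_lqgSystemErr_iff`).  The remaining claims rest on the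
following three ideas.

*Reduction to a compact perturbation of the identity.*  A profile with second derivative `F` and fluxes
`c i` at the points `η i` is a twofold primitive of `F` corrected by primitives of step functions,
subject to the flux balance `∫ F = ∑ i, c i` (`isProfile_iff_isSolution`).  In this form a rod whose
fluxes and sources depend linearly on its profile obeys an equation `Z - T Z = h` in `C[0,1]`, where `T`
is compact because the Volterra operator `L² → C[0,1]` is.  The Fredholm alternative then yields, at
every complex `μ`, an eigenfunction or a compact solution operator
(`eigenfunction_or_solution_operator`).  Back substitution gives the same alternative for the combined
system, together with its spectrum (`lqgSystemErr_alternative`).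

*Sectoriality.*  Integration by parts gives the energy identity `IsSolution.inner_eq`.  Its boundary and
source terms are bounded by squares of supremum norms, which interpolation absorbs into the Dirichlet
integral (`norm_prof_le`, `exists_garding`).  Hence on the Hilbert space `L² ⊕ L²` the numerical range
of the combined system lies in a translate of the sector `Re q + |Im q| ≤ 0`.

*Stability from the spectrum.*  For such an operator `A` the exponentials of the Yosida approximations
are contractions on the sector `|Im z| ≤ Re z`, up to a shift.  Their limits are holomorphic orbits, so
every initial state has a trajectory, and Cauchy's estimate bounds its velocity
(`exists_holomorphic_orbit`).  The time-one map `T` is therefore compact.  On each of its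
finite-dimensional eigenspaces the generator has an eigenvector, so the nonzero spectrum of `T` consists
of exponentials of eigenvalues of `A`.  If these have negative real part, then `T` has spectral radius
less than one and its powers tend to zero (`IsSectorial.asymptoticallyStable`).  The velocities tend to
zero as well, and the supremum norms, being controlled by state and velocity, follow.

The linear-quadratic gain is covered because its kernel is a uniformly convergent cosine series: the
coefficients are of order `n⁻²`.
-/

noncomputable section

namespace HeatRod

/-! ### Resolvents -/

section Resolvent

variable {E : Type*} [NormedAddCommGroup E] [NormedSpace ℂ E]

/-- `R` is the resolvent `(μ - A)⁻¹` of the operator `A` with graph `G`. -/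
def IsResolvent (G : Set (E × E)) (μ : ℂ) (R : E →L[ℂ] E) : Prop :=
  ∀ w g : E, (w, μ • w - g) ∈ G ↔ w = R g

variable {G : Set (E × E)} {μ ν : ℂ} {R R' : E →L[ℂ] E}

lemma notMem_spec_iff : μ ∉ spec G ↔ ∃ R, IsResolvent G μ R := by
  simp [spec, IsResolvent]

lemma IsResolvent.mem_iff (h : IsResolvent G μ R) (w v : E) :
    (w, v) ∈ G ↔ w = R (μ • w - v) := by
  have := h w (μ • w - v)
  rwa [sub_sub_cancel] at this

lemma IsResolvent.mem (h : IsResolvent G μ R) (g : E) : (R g, μ • R g - g) ∈ G :=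
  (h (R g) g).2 rfl

lemma IsResolvent.add_mem (h : IsResolvent G μ R) {w v w' v' : E} (h₁ : (w, v) ∈ G)
    (h₂ : (w', v') ∈ G) : (w + w', v + v') ∈ G := by
  rw [h.mem_iff] at *
  conv_lhs => rw [h₁, h₂, ← map_add]
  congr 1
  module

lemma IsResolvent.smul_mem (h : IsResolvent G μ R) (c : ℂ) {w v : E} (h₁ : (w, v) ∈ G) :
    (c • w, c • v) ∈ G := by
  rw [h.mem_iff] at *
  conv_lhs => rw [h₁, ← map_smul]
  congr 1
  module

lemma IsResolvent.sub_mem (h : IsResolvent G μ R) {w v w' v' : E} (h₁ : (w, v) ∈ G)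
    (h₂ : (w', v') ∈ G) : (w - w', v - v') ∈ G := by
  have := h.add_mem h₁ (h.smul_mem (-1) h₂)
  simpa [sub_eq_add_neg] using this

lemma IsResolvent.isClosed (h : IsResolvent G μ R) : IsClosed G := by
  have : G = {p : E × E | p.1 = R (μ • p.1 - p.2)} := by
    ext ⟨w, v⟩
    exact h.mem_iff w v
  rw [this]
  exact isClosed_eq continuous_fst (by fun_prop)

lemma IsResolvent.resolvent_identity (h : IsResolvent G μ R) (h' : IsResolvent G ν R') (x : E) :
    R' x = (μ - ν) • R (R' x) + R x := by
  refine ((h.mem_iff _ _).1 (h'.mem x)).trans ?_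
  rw [← map_smul R, ← map_add R]
  congr 1
  module

lemma IsResolvent.commute (h : IsResolvent G μ R) (h' : IsResolvent G ν R') : Commute R R' := by
  ext x
  change R (R' x) = R' (R x)
  rcases eq_or_ne μ ν with rfl | hne
  · have : R = R' := by
      ext y
      exact (h' _ _).1 (h.mem y)
    rw [this]
  · have h₁ := h.resolvent_identity h' x
    have h₂ := h'.resolvent_identity h x
    have h₃ : (μ - ν) • (R (R' x) - R' (R x)) = 0 := by
      have : (μ - ν) • (R (R' x) - R' (R x)) =
        ((μ - ν) • R (R' x) + R x) + ((ν - μ) • R' (R x) + R' x) - R x - R' x := by module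
      rw [this, ← h₁, ← h₂]
      abel
    exact sub_eq_zero.1 ((smul_eq_zero.1 h₃).resolve_left (sub_ne_zero.2 hne))

end Resolvent

/-! ### Holomorphic semigroups generated by sectorial operators -/

section Generation

variable {H : Type*} [NormedAddCommGroup H] [InnerProductSpace ℂ H]

/-- The energy estimate behind uniqueness and continuous dependence of trajectories. -/
lemma norm_le_exp_of_dissipative {u v : ℝ → H} {ω : ℝ} (hu : ContinuousOn u (Ici 0))
    (hd : ∀ t > 0, HasDerivAt u (v t) t) (hv : ∀ t > 0, (inner ℂ (u t) (v t)).re ≤ ω * ‖u t‖ ^ 2)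
    {t : ℝ} (ht : 0 ≤ t) : ‖u t‖ ≤ Real.exp (ω * t) * ‖u 0‖ := by
  let _ : InnerProductSpace ℝ H := InnerProductSpace.rclikeToReal ℂ H
  set φ : ℝ → ℝ := fun t => Real.exp (-2 * ω * t) * ‖u t‖ ^ 2 with hφ
  have hder : ∀ t > 0, HasDerivAt φ
      (Real.exp (-2 * ω * t) * (2 * (inner ℂ (u t) (v t)).re - 2 * ω * ‖u t‖ ^ 2)) t := by
    intro t ht
    have h₁ : HasDerivAt (fun t : ℝ => Real.exp (-2 * ω * t))
        (Real.exp (-2 * ω * t) * (-2 * ω)) t := by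
      simpa using ((hasDerivAt_id t).const_mul (-2 * ω)).exp
    have h₂ := (hd t ht).norm_sq
    have h₃ : inner ℝ (u t) (v t) = (inner ℂ (u t) (v t)).re := rfl
    rw [h₃] at h₂
    refine (h₁.mul h₂).congr_deriv ?_
    ring
  have hanti : AntitoneOn φ (Ici 0) := by
    refine antitoneOn_of_deriv_nonpos (convex_Ici 0) ?_ ?_ ?_
    · exact (by fun_prop : Continuous fun t : ℝ => Real.exp (-2 * ω * t)).continuousOn.mul
        (hu.norm.pow 2)
    · rw [interior_Ici]
      exact fun t ht => (hder t ht).differentiableAt.differentiableWithinAt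
    · rw [interior_Ici]
      intro t ht
      rw [(hder t ht).deriv]
      exact mul_nonpos_of_nonneg_of_nonpos (Real.exp_pos _).le (by linarith [hv t ht])
  have hle := hanti (mem_Ici.2 le_rfl) (mem_Ici.2 ht) ht
  simp only [hφ, mul_zero, Real.exp_zero, one_mul] at hle
  refine le_of_sq_le_sq ?_ (by positivity)
  have hexp : Real.exp (ω * t) ^ 2 * Real.exp (-2 * ω * t) = 1 := by
    rw [sq, ← Real.exp_add, ← Real.exp_add, Real.exp_eq_one_iff]
    ring
  calc ‖u t‖ ^ 2 = Real.exp (ω * t) ^ 2 * (Real.exp (-2 * ω * t) * ‖u t‖ ^ 2) := by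
        rw [← mul_assoc, hexp, one_mul]
    _ ≤ Real.exp (ω * t) ^ 2 * ‖u 0‖ ^ 2 := by gcongr
    _ = _ := by ring

/-- The closed sector of half-angle `π/4` about the positive axis. -/
def sector : Set ℂ := {z | |z.im| ≤ z.re}

/-- The interior of `sector`. -/
def openSector : Set ℂ := {z | |z.im| < z.re}

lemma isOpen_openSector : IsOpen openSector :=
  isOpen_lt (by fun_prop) (by fun_prop)

lemma openSector_subset : openSector ⊆ sector := fun z (hz : |z.im| < z.re) => hz.le

/-- The numerical range condition `Re q + |Im q| ≤ 0` is dual to the sector: the product of `q` with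
an element of the sector has nonpositive real part. -/
lemma re_mul_nonpos {z q : ℂ} (hz : z ∈ sector) (hq : q.re + |q.im| ≤ 0) : (z * q).re ≤ 0 := by
  have hz : |z.im| ≤ z.re := hz
  have h₁ : -(z.im * q.im) ≤ |z.im| * |q.im| := by
    rw [← abs_mul]; exact neg_le_abs _
  have h₂ : |z.im| * |q.im| ≤ z.re * |q.im| := by gcongr
  have h₃ : z.re * (q.re + |q.im|) ≤ 0 :=
    mul_nonpos_of_nonneg_of_nonpos ((abs_nonneg _).trans hz) hq
  rw [Complex.mul_re]
  nlinarith

variable [CompleteSpace H]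

/-- The exponential of a bounded operator whose numerical range lies in `Re q + |Im q| ≤ 0` is a
contraction on the whole sector, since the rotated operators are still dissipative. -/
lemma norm_exp_smul_apply_le {B : H →L[ℂ] H}
    (hB : ∀ x, (inner ℂ x (B x)).re + |(inner ℂ x (B x)).im| ≤ 0) {z : ℂ} (hz : z ∈ sector)
    (x : H) : ‖NormedSpace.exp (z • B) x‖ ≤ ‖x‖ := by
  have hd : ∀ t : ℝ, HasDerivAt (fun t : ℝ => NormedSpace.exp (t • (z • B)) x)
      ((z • B) (NormedSpace.exp (t • (z • B)) x)) t := by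
    intro t
    exact ((ContinuousLinearMap.apply ℂ H x).restrictScalars ℝ).hasFDerivAt.comp_hasDerivAt t
      (hasDerivAt_exp_smul_const' (𝕂 := ℝ) (z • B) t)
  have := norm_le_exp_of_dissipative (ω := 0)
    (u := fun t : ℝ => NormedSpace.exp (t • (z • B)) x)
    (fun t _ => (hd t).continuousAt.continuousWithinAt) (fun t _ => hd t) (fun t _ => by
      rw [smul_apply, inner_smul_right, zero_mul]
      exact re_mul_nonpos hz (hB _)) zero_le_one
  simpa using this

lemma hasDerivAt_exp_smul_apply (B : H →L[ℂ] H) (x : H) (z : ℂ) :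
    HasDerivAt (fun z : ℂ => NormedSpace.exp (z • B) x) (B (NormedSpace.exp (z • B) x)) z := by
  have := (hasDerivAt_exp_smul_const' (𝕂 := ℂ) B z).clm_apply (hasDerivAt_const z x)
  simpa using this

lemma norm_exp_sub_exp_apply_le {B B' : H →L[ℂ] H} (hc : Commute B B')
    (hB : ∀ x, (inner ℂ x (B x)).re + |(inner ℂ x (B x)).im| ≤ 0)
    (hB' : ∀ x, (inner ℂ x (B' x)).re + |(inner ℂ x (B' x)).im| ≤ 0)
    {z : ℂ} (hz : z ∈ sector) (x : H) :
    ‖NormedSpace.exp (z • B) x - NormedSpace.exp (z • B') x‖ ≤ ‖z‖ * ‖B x - B' x‖ := by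
  -- interpolate between the two exponentials along `exp (s z B) exp ((1 - s) z B')`
  set f : ℝ → H := fun s => NormedSpace.exp (s • (z • B)) (NormedSpace.exp ((1 - s) • (z • B')) x)
    with hf
  have hcs : ∀ s : ℝ, Commute (B - B') (NormedSpace.exp (s • (z • B'))) := fun s =>
    ((((hc.sub_left (Commute.refl B')).smul_right z).smul_right s)).exp_right
  have hder : ∀ s : ℝ, HasDerivAt f (NormedSpace.exp (s • (z • B))
      (NormedSpace.exp ((1 - s) • (z • B')) (z • (B x - B' x)))) s := by
    intro s
    have h₁ := hasDerivAt_exp_smul_const (𝕂 := ℝ) (z • B) s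
    have h₂ : HasDerivAt (fun s : ℝ => NormedSpace.exp ((1 - s) • (z • B')))
        (-((z • B') * NormedSpace.exp ((1 - s) • (z • B')))) s := by
      have := (hasDerivAt_exp_smul_const' (𝕂 := ℝ) (z • B') (1 - s)).scomp s
        ((hasDerivAt_id s).const_sub 1)
      simpa [Function.comp_def] using this
    refine (((ContinuousLinearMap.apply ℂ H x).restrictScalars ℝ).hasFDerivAt.comp_hasDerivAt s
      (h₁.mul h₂)).congr_deriv ?_
    change (NormedSpace.exp (s • (z • B)) * (z • B)) (NormedSpace.exp ((1 - s) • (z • B')) x) +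
      NormedSpace.exp (s • (z • B))
        ((-((z • B') * NormedSpace.exp ((1 - s) • (z • B')))) x) = _
    have hcx := congrArg (fun L : H →L[ℂ] H => L x) (hcs (1 - s)).eq
    simp only [mul_apply_eq_comp, sub_apply] at hcx
    simp only [mul_apply_eq_comp, smul_apply,
      neg_apply, map_neg]
    rw [← sub_eq_add_neg, ← map_sub, ← smul_sub, hcx, ← map_smul]
  have hbound : ∀ s ∈ Icc (0 : ℝ) 1, ‖NormedSpace.exp (s • (z • B))
      (NormedSpace.exp ((1 - s) • (z • B')) (z • (B x - B' x)))‖ ≤ ‖z‖ * ‖B x - B' x‖ := by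
    intro s hs
    have hsec : ∀ r : ℝ, 0 ≤ r → (r : ℂ) * z ∈ sector := fun r hr => by
      simp only [sector, mem_ofPred_eq, Complex.mul_im, Complex.mul_re, Complex.ofReal_re,
        Complex.ofReal_im, zero_mul, add_zero, sub_zero, abs_mul, abs_of_nonneg hr]
      exact mul_le_mul_of_nonneg_left hz hr
    have e : ∀ (r : ℝ) (C : H →L[ℂ] H), r • (z • C) = ((r : ℂ) * z) • C := fun r C => by
      rw [mul_smul, Complex.coe_smul]
    rw [e, e, ← norm_smul]
    exact (norm_exp_smul_apply_le hB (hsec s hs.1) _).trans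
      (norm_exp_smul_apply_le hB' (hsec (1 - s) (by linarith [hs.2])) _)
  have := norm_image_sub_le_of_norm_deriv_le_segment_01' (f := f)
    (fun s _ => (hder s).hasDerivWithinAt) (fun s hs => hbound s (Ico_subset_Icc_self hs))
  simpa [hf] using this

end Generation

section Yosida

variable {H : Type*} [NormedAddCommGroup H] [InnerProductSpace ℂ H] {G : Set (H × H)}
  {R : H →L[ℂ] H} {c : ℝ}

/-- The Yosida approximation `c A (c - A)⁻¹` of `A`, written with the resolvent `R = (c - A)⁻¹`. -/
def yosida (c : ℝ) (R : H →L[ℂ] H) : H →L[ℂ] H := (c : ℂ) • ((c : ℂ) • R - 1)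

lemma yosida_apply (x : H) : yosida c R x = (c : ℂ) • ((c : ℂ) • R x - x) := by
  simp [yosida]

lemma IsResolvent.yosida_mem (h : IsResolvent G c R) (x : H) :
    ((c : ℂ) • R x, yosida c R x) ∈ G := by
  rw [yosida_apply]
  exact h.smul_mem _ (h.mem x)

lemma IsResolvent.yosida_apply_of_mem (h : IsResolvent G c R) {w v : H} (hw : (w, v) ∈ G) :
    yosida c R w = (c : ℂ) • R v := by
  have h₁ := (h.mem_iff w v).1 hw
  rw [map_sub, map_smul] at h₁
  rw [yosida_apply]
  congr 1
  nth_rw 2 [h₁]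
  abel

lemma IsResolvent.yosida_numericalRange (h : IsResolvent G c R) (hc : 0 < c)
    (hG : ∀ w v, (w, v) ∈ G → (inner ℂ w v).re + |(inner ℂ w v).im| ≤ 0) (x : H) :
    (inner ℂ x (yosida c R x)).re + |(inner ℂ x (yosida c R x)).im| ≤ 0 := by
  have hx : x = (c : ℂ) • R x - ((c⁻¹ : ℝ) : ℂ) • yosida c R x := by
    rw [yosida_apply, smul_smul, ← Complex.ofReal_mul, inv_mul_cancel₀ hc.ne']
    simp
  have h₁ : inner ℂ x (yosida c R x) = inner ℂ ((c : ℂ) • R x) (yosida c R x) -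
      ((c⁻¹ * ‖yosida c R x‖ ^ 2 : ℝ) : ℂ) := by
    generalize (c : ℂ) • R x = y at hx ⊢
    generalize yosida c R x = b at hx ⊢
    conv_lhs => rw [hx, inner_sub_left, inner_smul_left b b, inner_self_eq_norm_sq_to_K]
    simp
  have h₂ := hG _ _ (h.yosida_mem x)
  have h₃ : 0 ≤ c⁻¹ * ‖yosida c R x‖ ^ 2 := by positivity
  rw [h₁, Complex.sub_re, Complex.sub_im, Complex.ofReal_re, Complex.ofReal_im, sub_zero]
  linarith

lemma IsResolvent.norm_smul_apply_le (h : IsResolvent G c R) (hc : 0 < c)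
    (hG : ∀ w v, (w, v) ∈ G → (inner ℂ w v).re ≤ 0) (x : H) : ‖(c : ℂ) • R x‖ ≤ ‖x‖ := by
  have h₁ := hG _ _ (h.yosida_mem x)
  rw [yosida_apply, inner_smul_right, Complex.re_ofReal_mul, inner_sub_right, Complex.sub_re] at h₁
  have h₂ : (inner ℂ ((c : ℂ) • R x) ((c : ℂ) • R x)).re = ‖(c : ℂ) • R x‖ ^ 2 := by
    rw [inner_self_eq_norm_sq_to_K]; norm_cast
  rw [h₂] at h₁
  have h₃ : (inner ℂ ((c : ℂ) • R x) x).re ≤ ‖(c : ℂ) • R x‖ * ‖x‖ :=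
    (Complex.re_le_norm _).trans (norm_inner_le_norm _ _)
  by_contra! hlt
  have h₄ : 0 < ‖(c : ℂ) • R x‖ := (norm_nonneg _).trans_lt hlt
  have : 0 < c * (‖(c : ℂ) • R x‖ ^ 2 - (inner ℂ ((c : ℂ) • R x) x).re) := by
    apply mul_pos hc
    nlinarith
  linarith

/-- A maximal dissipative operator on a Hilbert space is densely defined. -/
lemma IsResolvent.dense_domain [CompleteSpace H] (h : IsResolvent G c R) (hc : 0 < c)
    (hG : ∀ w v, (w, v) ∈ G → (inner ℂ w v).re ≤ 0) (hz : ∀ v, (0, v) ∈ G → v = 0) :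
    Dense {w | ∃ v, (w, v) ∈ G} := by
  have hset : {w | ∃ v, (w, v) ∈ G} = (LinearMap.range (R : H →ₗ[ℂ] H) : Set H) := by
    ext w
    constructor
    · rintro ⟨v, hv⟩
      exact ⟨_, ((h.mem_iff w v).1 hv).symm⟩
    · rintro ⟨g, rfl⟩
      exact ⟨_, h.mem g⟩
  rw [hset, Submodule.dense_iff_topologicalClosure_eq_top,
    Submodule.topologicalClosure_eq_top_iff, Submodule.eq_bot_iff]
  intro x hx
  have h₀ : inner ℂ (R x) x = 0 := (Submodule.mem_orthogonal _ _).1 hx _ ⟨x, rfl⟩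
  have h₁ := hG _ _ (h.mem x)
  rw [inner_sub_right, h₀, sub_zero, inner_smul_right, inner_self_eq_norm_sq_to_K] at h₁
  have h₂ : c * ‖R x‖ ^ 2 ≤ 0 := by
    have : ((c : ℂ) * ((‖R x‖ : ℂ)) ^ 2).re = c * ‖R x‖ ^ 2 := by norm_cast
    rw [← this]; exact h₁
  have h₃ : R x = 0 := by
    have : ‖R x‖ ^ 2 ≤ 0 := by
      by_contra! hp
      exact absurd (mul_pos hc hp) (not_lt.2 h₂)
    simpa using le_antisymm this (by positivity)
  have h₄ := h.mem x
  rw [h₃] at h₄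
  simpa using hz _ h₄

/-- The orbits of the semigroup generated by a dissipative operator whose numerical range lies in the
sector opposite to `sector`, as limits of the exponentials of the Yosida approximations. -/
theorem exists_holomorphic_orbit [CompleteSpace H]
    (hG : ∀ w v, (w, v) ∈ G → (inner ℂ w v).re + |(inner ℂ w v).im| ≤ 0)
    (hz : ∀ v, (0, v) ∈ G → v = 0) (hR : ∀ c : ℝ, 0 < c → ∃ R, IsResolvent G c R) (x : H) :
    ∃ U : ℂ → H, U 0 = x ∧ ContinuousOn U sector ∧ DifferentiableOn ℂ U openSector ∧
      (∀ z ∈ openSector, (U z, deriv U z) ∈ G) ∧ ∀ z ∈ sector, ‖U z‖ ≤ ‖x‖ := by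
  have hG' : ∀ w v, (w, v) ∈ G → (inner ℂ w v).re ≤ 0 := fun w v hwv =>
    (le_add_of_nonneg_right (abs_nonneg _)).trans (hG w v hwv)
  have hpos : ∀ n : ℕ, (0 : ℝ) < n + 1 := fun n => by positivity
  choose R hR using fun n : ℕ => hR (n + 1) (hpos n)
  set J : ℕ → H → H := fun n x => ((n + 1 : ℝ) : ℂ) • R n x with hJ
  set Y : ℕ → H →L[ℂ] H := fun n => yosida (n + 1) (R n) with hY
  have hJle : ∀ n x, ‖J n x‖ ≤ ‖x‖ := fun n x => (hR n).norm_smul_apply_le (hpos n) hG' x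
  have hJsub : ∀ n x y, J n x - J n y = J n (x - y) := fun n x y => by
    simp only [hJ, map_sub, smul_sub]
  have hYnum : ∀ n x, (inner ℂ x (Y n x)).re + |(inner ℂ x (Y n x)).im| ≤ 0 := fun n x =>
    (hR n).yosida_numericalRange (hpos n) hG x
  have hYcomm : ∀ n m, Commute (Y n) (Y m) := fun n m => by
    have h₁ := (hR n).commute (hR m)
    have h₂ := ((h₁.smul_left ((n + 1 : ℝ) : ℂ)).smul_right ((m + 1 : ℝ) : ℂ))
    have h₃ := (h₂.sub_left (Commute.one_left _)).sub_right (Commute.one_right _)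
    exact (h₃.smul_left _).smul_right _
  have hD : Dense {w | ∃ v, (w, v) ∈ G} := (hR 0).dense_domain (hpos 0) hG' hz
  -- `J n → 1` strongly: clear on the domain, and the `J n` are contractions
  have hJlim : ∀ y, Tendsto (fun n => J n y) atTop (𝓝 y) := by
    intro y
    rw [Metric.tendsto_atTop]
    intro ε hε
    obtain ⟨w, hyw, v, hv⟩ : ∃ w ∈ Metric.ball y (ε / 3), ∃ v, (w, v) ∈ G := by
      obtain ⟨w, h₁, h₂⟩ := hD.exists_dist_lt y (show 0 < ε / 3 by positivity)
      exact ⟨w, by rwa [Metric.mem_ball, dist_comm], h₁⟩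
    rw [Metric.mem_ball, dist_eq_norm] at hyw
    obtain ⟨N, hN⟩ := exists_nat_gt (‖v‖ / (ε / 3))
    refine ⟨N, fun n hn => ?_⟩
    have hw : ((n + 1 : ℝ) : ℂ) • (J n w - w) = J n v := by
      rw [← yosida_apply, (hR n).yosida_apply_of_mem hv]
    have hw' : ‖J n w - w‖ < ε / 3 := by
      have h₁ : (n + 1 : ℝ) * ‖J n w - w‖ ≤ ‖v‖ := by
        have := hJle n v
        rw [← hw, norm_smul, Complex.norm_real, Real.norm_of_nonneg (hpos n).le] at this
        exact this
      have h₂ : ‖v‖ < (n + 1 : ℝ) * (ε / 3) := by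
        rw [div_lt_iff₀ (by positivity)] at hN
        refine hN.trans_le ?_
        have : (N : ℝ) ≤ n + 1 := by exact_mod_cast hn.trans n.le_succ
        gcongr
      exact lt_of_mul_lt_mul_left (h₁.trans_lt h₂) (hpos n).le
    rw [dist_eq_norm]
    calc ‖J n y - y‖ = ‖J n (y - w) + (J n w - w) + (w - y)‖ := by
          rw [← hJsub]; congr 1; abel
      _ ≤ ‖J n (y - w)‖ + ‖J n w - w‖ + ‖w - y‖ := norm_add₃_le
      _ < ε / 3 + ε / 3 + ε / 3 := by
          have := hJle n (y - w)
          rw [norm_sub_rev y w] at this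
          linarith
      _ = ε := by ring
  set U : ℕ → ℂ → H := fun n z => NormedSpace.exp (z • Y n) x with hU
  have hUle : ∀ n, ∀ z ∈ sector, ‖U n z‖ ≤ ‖x‖ := fun n z hz =>
    norm_exp_smul_apply_le (hYnum n) hz x
  have hUder : ∀ n z, HasDerivAt (U n) (Y n (U n z)) z := fun n z =>
    hasDerivAt_exp_smul_apply (Y n) x z
  have hCauchy : ∀ r : ℝ, UniformCauchySeqOn U atTop (sector ∩ Metric.ball 0 r) := by
    intro r
    rw [Metric.uniformCauchySeqOn_iff]
    intro ε hε
    obtain ⟨w, ⟨v, hv⟩, hxw⟩ := hD.exists_dist_lt x (show 0 < ε / 4 by positivity)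
    rw [dist_eq_norm] at hxw
    have hc := (hJlim v).cauchySeq
    rw [Metric.cauchySeq_iff] at hc
    obtain ⟨N, hN⟩ := hc (ε / (2 * (|r| + 1))) (by positivity)
    refine ⟨N, fun m hm n hn z hz => ?_⟩
    have hzr : ‖z‖ < r := by simpa using hz.2
    have h₁ : ∀ k, ‖U k z - NormedSpace.exp (z • Y k) w‖ < ε / 4 := fun k => by
      rw [hU, ← map_sub]
      exact (norm_exp_smul_apply_le (hYnum k) hz.1 _).trans_lt hxw
    have h₂ := norm_exp_sub_exp_apply_le (hYcomm m n) (hYnum m) (hYnum n) hz.1 w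
    have h₃ : ∀ k, Y k w = J k v := fun k => (hR k).yosida_apply_of_mem hv
    rw [h₃, h₃] at h₂
    have h₄ := hN m hm n hn
    rw [dist_eq_norm] at h₄
    have h₅ : ‖z‖ * ‖J m v - J n v‖ ≤ ε / 2 := by
      calc ‖z‖ * ‖J m v - J n v‖ ≤ (|r| + 1) * (ε / (2 * (|r| + 1))) := by
            gcongr
            linarith [le_abs_self r]
        _ = ε / 2 := by field_simp
    rw [dist_eq_norm]
    have h₆ := h₁ m
    have h₇ := h₁ n
    rw [norm_sub_rev] at h₇
    calc ‖U m z - U n z‖ = ‖(U m z - NormedSpace.exp (z • Y m) w) +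
          (NormedSpace.exp (z • Y m) w - NormedSpace.exp (z • Y n) w) +
          (NormedSpace.exp (z • Y n) w - U n z)‖ := by congr 1; abel
      _ ≤ _ := norm_add₃_le
      _ < ε := by linarith
  have hlim : ∀ z, ∃ l, z ∈ sector → Tendsto (fun n => U n z) atTop (𝓝 l) := by
    intro z
    by_cases hz : z ∈ sector
    · obtain ⟨l, hl⟩ := cauchySeq_tendsto_of_complete
        ((hCauchy (‖z‖ + 1)).cauchySeq (x := z) ⟨hz, by simp⟩)
      exact ⟨l, fun _ => hl⟩
    · exact ⟨0, fun h => absurd h hz⟩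
  choose V hV using hlim
  have hloc : TendstoLocallyUniformlyOn U V atTop sector := by
    refine tendstoLocallyUniformlyOn_of_forall_exists_nhds fun z hz => ?_
    refine ⟨sector ∩ Metric.ball 0 (‖z‖ + 1), ?_, ?_⟩
    · exact inter_mem_nhdsWithin _ (Metric.isOpen_ball.mem_nhds (by simp))
    · exact (hCauchy _).tendstoUniformlyOn_of_tendsto fun y hy => hV y hy.1
  have hloc' := hloc.mono openSector_subset
  have hdiff : ∀ n, DifferentiableOn ℂ (U n) openSector := fun n z _ =>
    (hUder n z).differentiableAt.differentiableWithinAt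
  refine ⟨V, ?_, hloc.continuousOn (Frequently.of_forall fun n z _ =>
    (hUder n z).continuousAt.continuousWithinAt), hloc'.differentiableOn (.of_forall hdiff)
      isOpen_openSector, fun z hz => ?_, fun z hz => ?_⟩
  · refine tendsto_nhds_unique (hV 0 (by simp [sector])) ?_
    simp [hU]
  · have h₁ : Tendsto (fun n => Y n (U n z)) atTop (𝓝 (deriv V z)) := by
      have := (hloc'.deriv (.of_forall hdiff) isOpen_openSector).tendsto_at hz
      exact this.congr fun n => (hUder n z).deriv
    have h₂ : Tendsto (fun n => J n (U n z)) atTop (𝓝 (V z)) := by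
      have h₃ : Tendsto (fun n => J n (U n z - V z)) atTop (𝓝 0) := by
        refine squeeze_zero_norm (fun n => hJle n _) ?_
        have := (hV z (openSector_subset hz)).sub_const (V z)
        rw [sub_self] at this
        simpa using this.norm
      have := h₃.add (hJlim (V z))
      rw [zero_add] at this
      refine this.congr fun n => ?_
      rw [← hJsub]; abel
    exact (hR 0).isClosed.mem_of_tendsto (h₂.prodMk_nhds h₁)
      (.of_forall fun n => (hR n).yosida_mem _)
  · exact le_of_tendsto (hV z hz).norm (.of_forall fun n => hUle n z hz)

end Yosida

/-! ### Asymptotic stability of sectorial operators with compact resolvent -/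

section Stability

variable {H : Type*} [NormedAddCommGroup H] [InnerProductSpace ℂ H] {G : Set (H × H)} {ω : ℝ}

/-- The operator with graph `G` is single-valued, its numerical range lies in the sector
`Re q + |Im q| ≤ ω`, and off its eigenvalues it has a compact resolvent. -/
structure IsSectorial (G : Set (H × H)) (ω : ℝ) : Prop where
  nonneg : 0 ≤ ω
  numericalRange : ∀ w v, (w, v) ∈ G → (inner ℂ w v).re + |(inner ℂ w v).im| ≤ ω * ‖w‖ ^ 2
  eq_zero : ∀ v, (0, v) ∈ G → v = 0
  eigen_or_resolvent : ∀ μ : ℂ, (∃ w ≠ 0, (w, μ • w) ∈ G) ∨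
    ∃ R : H →L[ℂ] H, IsCompactOperator R ∧ IsResolvent G μ R

namespace IsSectorial

lemma re_inner_le (h : IsSectorial G ω) {w v : H} (hwv : (w, v) ∈ G) :
    (inner ℂ w v).re ≤ ω * ‖w‖ ^ 2 :=
  (le_add_of_nonneg_right (abs_nonneg _)).trans (h.numericalRange w v hwv)

lemma exists_compact_resolvent (h : IsSectorial G ω) {c : ℝ} (hc : ω < c) :
    ∃ R : H →L[ℂ] H, IsCompactOperator R ∧ IsResolvent G c R := by
  refine (h.eigen_or_resolvent c).resolve_left ?_
  rintro ⟨w, hw, hwG⟩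
  have h₁ := h.re_inner_le hwG
  rw [inner_smul_right, inner_self_eq_norm_sq_to_K] at h₁
  have h₂ : c * ‖w‖ ^ 2 ≤ ω * ‖w‖ ^ 2 := by
    have : ((c : ℂ) * ((‖w‖ : ℂ)) ^ 2).re = c * ‖w‖ ^ 2 := by norm_cast
    rw [← this]; exact h₁
  have h₃ : 0 < ‖w‖ ^ 2 := by have := norm_pos_iff.2 hw; positivity
  exact absurd (le_of_mul_le_mul_right h₂ h₃) (not_le.2 hc)

/-- Some compact resolvent; through it the graph is seen to be a closed subspace. -/
lemma exists_resolvent (h : IsSectorial G ω) :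
    ∃ (c : ℝ) (R : H →L[ℂ] H), IsCompactOperator R ∧ IsResolvent G c R :=
  ⟨ω + 1, h.exists_compact_resolvent (by linarith)⟩

lemma eq_of_mem (h : IsSectorial G ω) {w v v' : H} (h₁ : (w, v) ∈ G) (h₂ : (w, v') ∈ G) :
    v = v' := by
  obtain ⟨c, R, -, hR⟩ := h.exists_resolvent
  have := hR.sub_mem h₁ h₂
  rw [sub_self] at this
  exact sub_eq_zero.1 (h.eq_zero _ this)

end IsSectorial

lemma IsTrajectory.norm_le (h : IsSectorial G ω) {u : ℝ → H} (hu : IsTrajectory G u) {t : ℝ}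
    (ht : 0 ≤ t) : ‖u t‖ ≤ Real.exp (ω * t) * ‖u 0‖ := by
  obtain ⟨hc, hd⟩ := hu
  choose! v hv using hd
  exact norm_le_exp_of_dissipative hc (fun t ht => (hv t ht).1)
    (fun t ht => h.re_inner_le (hv t ht).2) ht

lemma IsTrajectory.add {E : Type*} [NormedAddCommGroup E] [NormedSpace ℂ E] {G : Set (E × E)}
    {μ : ℂ} {R : E →L[ℂ] E} (h : IsResolvent G μ R) {u u' : ℝ → E} (hu : IsTrajectory G u)
    (hu' : IsTrajectory G u') : IsTrajectory G (u + u') := by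
  refine ⟨hu.1.add hu'.1, fun t ht => ?_⟩
  obtain ⟨v, hv, hG⟩ := hu.2 t ht
  obtain ⟨v', hv', hG'⟩ := hu'.2 t ht
  exact ⟨v + v', hv.add hv', h.add_mem hG hG'⟩

lemma IsTrajectory.smul {E : Type*} [NormedAddCommGroup E] [NormedSpace ℂ E] {G : Set (E × E)}
    {μ : ℂ} {R : E →L[ℂ] E} (h : IsResolvent G μ R) (c : ℂ) {u : ℝ → E}
    (hu : IsTrajectory G u) : IsTrajectory G (c • u) := by
  refine ⟨hu.1.const_smul c, fun t ht => ?_⟩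
  obtain ⟨v, hv, hG⟩ := hu.2 t ht
  exact ⟨c • v, hv.const_smul c, h.smul_mem c hG⟩

lemma IsTrajectory.shift {E : Type*} [NormedAddCommGroup E] [NormedSpace ℂ E] {G : Set (E × E)}
    {u : ℝ → E} (hu : IsTrajectory G u) {s : ℝ} (hs : 0 ≤ s) :
    IsTrajectory G fun t => u (t + s) := by
  refine ⟨hu.1.comp (by fun_prop) fun t (ht : 0 ≤ t) => add_nonneg ht hs, fun t ht => ?_⟩
  obtain ⟨v, hv, hG⟩ := hu.2 (t + s) (by linarith)
  exact ⟨v, hv.comp_add_const t s, hG⟩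

/-- Trajectories are determined by their initial states. -/
lemma IsTrajectory.eqOn (h : IsSectorial G ω) {u u' : ℝ → H} (hu : IsTrajectory G u)
    (hu' : IsTrajectory G u') (h₀ : u 0 = u' 0) : EqOn u u' (Ici 0) := by
  obtain ⟨c, R, -, hR⟩ := h.exists_resolvent
  intro t ht
  have := (hu.add hR (hu'.smul hR (-1))).norm_le h ht
  simp only [Pi.add_apply, Pi.neg_apply, h₀, neg_smul, one_smul, add_neg_cancel, norm_zero,
    mul_zero, norm_le_zero_iff] at this
  exact eq_of_sub_eq_zero (by rwa [sub_eq_add_neg])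

lemma IsTrajectory.deriv_mem {E : Type*} [NormedAddCommGroup E] [NormedSpace ℂ E]
    {G : Set (E × E)} {u : ℝ → E} (hu : IsTrajectory G u) {t : ℝ} (ht : 0 < t) :
    HasDerivAt u (deriv u t) t ∧ (u t, deriv u t) ∈ G := by
  obtain ⟨v, hv, hG⟩ := hu.2 t ht
  rw [hv.deriv]
  exact ⟨hv, hG⟩

variable [CompleteSpace H]

/-- Every initial state has a trajectory, and parabolic smoothing bounds its velocity at time `1`. -/
theorem IsSectorial.exists_trajectory (h : IsSectorial G ω) : ∃ C : ℝ, ∀ x : H, ∃ u : ℝ → H,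
    IsTrajectory G u ∧ u 0 = x ∧ ‖deriv u 1‖ ≤ C * ‖x‖ := by
  -- the operator shifted by `-ω` generates a semigroup that is bounded on the sector
  set G' : Set (H × H) := {p | (p.1, p.2 + (ω : ℂ) • p.1) ∈ G} with hG'
  have hmem : ∀ w v, (w, v) ∈ G' ↔ (w, v + (ω : ℂ) • w) ∈ G := fun _ _ => Iff.rfl
  have hnum : ∀ w v, (w, v) ∈ G' → (inner ℂ w v).re + |(inner ℂ w v).im| ≤ 0 := by
    intro w v hwv
    have := h.numericalRange _ _ ((hmem w v).1 hwv)
    have e : inner ℂ w (v + (ω : ℂ) • w) = inner ℂ w v + ((ω * ‖w‖ ^ 2 : ℝ) : ℂ) := by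
      rw [inner_add_right, inner_smul_right, inner_self_eq_norm_sq_to_K]
      simp
    rw [e, Complex.add_re, Complex.add_im, Complex.ofReal_re, Complex.ofReal_im, add_zero] at this
    linarith
  have hres : ∀ c : ℝ, 0 < c → ∃ R, IsResolvent G' c R := by
    intro c hc
    obtain ⟨R, -, hR⟩ := h.exists_compact_resolvent (c := c + ω) (by linarith)
    refine ⟨R, fun w g => ?_⟩
    rw [hmem, ← hR w g]
    have : (c : ℂ) • w - g + (ω : ℂ) • w = ((c + ω : ℝ) : ℂ) • w - g := by
      push_cast; module
    rw [this]
  have hzero : ∀ v, (0, v) ∈ G' → v = 0 := fun v hv => by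
    have := (hmem 0 v).1 hv
    rw [smul_zero, add_zero] at this
    exact h.eq_zero v this
  obtain ⟨c, R, -, hR⟩ := h.exists_resolvent
  refine ⟨Real.exp ω * (2 + ω), fun x => ?_⟩
  obtain ⟨U, hU0, hUc, hUd, hUG, hUle⟩ := exists_holomorphic_orbit hnum hzero hres x
  have hreal : ∀ t : ℝ, 0 ≤ t → (t : ℂ) ∈ sector := fun t ht => by simpa [sector] using ht
  have hreal' : ∀ t : ℝ, 0 < t → (t : ℂ) ∈ openSector := fun t ht => by
    simpa [openSector] using ht
  have hder : ∀ t : ℝ, 0 < t → HasDerivAt (fun t : ℝ => ((Real.exp (ω * t) : ℝ) : ℂ) • U t)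
      (((Real.exp (ω * t) : ℝ) : ℂ) • (deriv U t + (ω : ℂ) • U t)) t := by
    intro t ht
    have h₁ : HasDerivAt U (deriv U t) (t : ℂ) :=
      ((hUd _ (hreal' t ht)).differentiableAt (isOpen_openSector.mem_nhds (hreal' t ht))).hasDerivAt
    have h₂ : HasDerivAt (fun t : ℝ => U t) (deriv U t) t := by
      simpa [Function.comp_def] using h₁.scomp t Complex.ofRealCLM.hasDerivAt
    have h₃ : HasDerivAt (fun t : ℝ => ((Real.exp (ω * t) : ℝ) : ℂ))
        ((Real.exp (ω * t) * ω : ℝ) : ℂ) t := by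
      simpa using (((hasDerivAt_id t).const_mul ω).exp).ofReal_comp
    refine (h₃.smul h₂).congr_deriv ?_
    push_cast
    module
  refine ⟨fun t : ℝ => ((Real.exp (ω * t) : ℝ) : ℂ) • U t, ⟨?_, fun t ht => ⟨_, hder t ht, ?_⟩⟩, ?_,
    ?_⟩
  · refine ContinuousOn.smul (by fun_prop) ?_
    exact hUc.comp Complex.continuous_ofReal.continuousOn fun t ht => hreal t ht
  · exact hR.smul_mem _ ((hmem _ _).1 (hUG _ (hreal' t ht)))
  · simp [hU0]
  · rw [(hder 1 one_pos).deriv, norm_smul, Complex.norm_real, Real.norm_of_nonneg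
      (Real.exp_pos _).le, mul_one, mul_assoc]
    refine mul_le_mul_of_nonneg_left ?_ (Real.exp_pos _).le
    -- Cauchy's estimate on the disc of radius `1/2` about `1`, which lies in the open sector
    have hball : Metric.closedBall (1 : ℂ) (1 / 2) ⊆ openSector := by
      intro z hz
      rw [Metric.mem_closedBall, dist_eq_norm] at hz
      have h₁ := (Complex.abs_im_le_norm (z - 1)).trans hz
      have h₂ := (Complex.abs_re_le_norm (z - 1)).trans hz
      have h₃ : ‖z - 1‖ ^ 2 ≤ (1 / 2) ^ 2 := by gcongr
      rw [← Complex.normSq_eq_norm_sq, Complex.normSq_apply] at h₃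
      simp only [Complex.sub_im, Complex.one_im, sub_zero, Complex.sub_re, Complex.one_re] at h₁ h₂ h₃
      have h₄ := (abs_le.1 h₂).1
      change |z.im| < z.re
      rw [abs_lt]
      constructor <;> nlinarith [sq_nonneg (z.im - (z.re - 1)), sq_nonneg (z.im + (z.re - 1))]
    have h₁ : ‖deriv U ((1 : ℝ) : ℂ)‖ ≤ 2 * ‖x‖ := by
      have := Complex.norm_deriv_le_of_forall_mem_sphere_norm_le (f := U) (c := 1) (R := 1 / 2)
        (C := ‖x‖) (by norm_num)
        (DifferentiableOn.diffContOnCl (by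
          rw [closure_ball _ (by norm_num)]
          exact hUd.mono hball))
        (fun z hz => hUle z (openSector_subset (hball (Metric.sphere_subset_closedBall hz))))
      rw [Complex.ofReal_one]
      linarith
    have h₂ : ‖(ω : ℂ) • U ((1 : ℝ) : ℂ)‖ ≤ ω * ‖x‖ := by
      rw [norm_smul, Complex.norm_real, Real.norm_of_nonneg h.nonneg]
      exact mul_le_mul_of_nonneg_left (hUle _ (hreal 1 zero_le_one)) h.nonneg
    calc _ ≤ _ := norm_add_le _ _
      _ ≤ _ := by linarith

/-- By Gelfand's formula, the powers of an operator of spectral radius less than one tend to zero. -/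
lemma tendsto_norm_pow_of_spectrum_lt [Nontrivial H] (T : H →L[ℂ] H)
    (hT : ∀ l ∈ spectrum ℂ T, ‖l‖ < 1) : Tendsto (fun n : ℕ => ‖T ^ n‖) atTop (𝓝 0) := by
  have h₁ : spectralRadius ℂ T < (1 : NNReal) :=
    spectrum.spectralRadius_lt_of_forall_lt T fun k hk => by exact_mod_cast hT k hk
  obtain ⟨r, hr, hr1⟩ := ENNReal.lt_iff_exists_nnreal_btwn.1 h₁
  have hr1 : r < 1 := by exact_mod_cast hr1
  have h₂ := (spectrum.gelfand_formula T).eventually_lt_const hr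
  have h₃ : ∀ᶠ n : ℕ in atTop, ‖T ^ n‖ ≤ (r : ℝ) ^ n := by
    filter_upwards [h₂, eventually_gt_atTop 0] with n hn hn0
    have hn' : (0 : ℝ) < n := by exact_mod_cast hn0
    rw [one_div, ENNReal.rpow_inv_lt_iff hn', ENNReal.rpow_natCast] at hn
    have : ‖T ^ n‖₊ < r ^ n := by exact_mod_cast hn
    exact_mod_cast this.le
  refine squeeze_zero' (.of_forall fun n => norm_nonneg _) h₃ ?_
  exact tendsto_pow_atTop_nhds_zero_of_lt_one r.2 (by exact_mod_cast hr1)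

end Stability

section Stability

variable {H : Type*} [NormedAddCommGroup H] [InnerProductSpace ℂ H] [CompleteSpace H]
  {G : Set (H × H)} {ω : ℝ}

/-- The time-one map `T` of the semigroup generated by a sectorial operator `A`, together with the
operator `V` sending an initial state to the velocity `A T` at time `1`. -/
lemma IsSectorial.exists_timeOne (h : IsSectorial G ω) : ∃ T V : H →L[ℂ] H,
    IsCompactOperator T ∧ (∀ x, (T x, V x) ∈ G) ∧ (∀ x, V (T x) = T (V x)) ∧
    ∀ u, IsTrajectory G u → ∀ t ≥ 0, u (t + 1) = T (u t) ∧ deriv u (t + 1) = V (u t) := by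
  obtain ⟨c, R, hRc, hR⟩ := h.exists_resolvent
  obtain ⟨C, hC⟩ := h.exists_trajectory
  choose S hS hS0 hSd using hC
  have hSG : ∀ x, (S x 1, deriv (S x) 1) ∈ G := fun x => ((hS x).deriv_mem one_pos).2
  have hadd : ∀ x y, S (x + y) 1 = S x 1 + S y 1 := fun x y =>
    (hS (x + y)).eqOn h ((hS x).add hR (hS y)) (by simp [hS0]) (mem_Ici.2 zero_le_one)
  have hsmul : ∀ (a : ℂ) x, S (a • x) 1 = a • S x 1 := fun a x =>
    (hS (a • x)).eqOn h ((hS x).smul hR a) (by simp [hS0]) (mem_Ici.2 zero_le_one)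
  set T : H →L[ℂ] H := LinearMap.mkContinuous
    { toFun := fun x => S x 1, map_add' := hadd, map_smul' := hsmul } (Real.exp (ω * 1))
    (fun x => by
      have := (hS x).norm_le h zero_le_one
      rwa [hS0] at this) with hT
  have hTapp : ∀ x, T x = S x 1 := fun x => rfl
  set V : H →L[ℂ] H := LinearMap.mkContinuous
    { toFun := fun x => deriv (S x) 1
      map_add' := fun x y => h.eq_of_mem (hSG (x + y)) (by
        rw [hadd]; exact hR.add_mem (hSG x) (hSG y))
      map_smul' := fun a x => h.eq_of_mem (hSG (a • x)) (by
        rw [hsmul]; exact hR.smul_mem a (hSG x)) } C hSd with hV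
  have hVapp : ∀ x, V x = deriv (S x) 1 := fun x => rfl
  have htraj : ∀ u, IsTrajectory G u → ∀ t ≥ 0,
      u (t + 1) = T (u t) ∧ deriv u (t + 1) = V (u t) := by
    intro u hu t ht
    have h₁ : u (t + 1) = T (u t) := by
      rw [hTapp, add_comm]
      exact (hu.shift ht).eqOn h (hS (u t)) (by simp [hS0]) (mem_Ici.2 zero_le_one)
    refine ⟨h₁, h.eq_of_mem (hu.deriv_mem (by linarith)).2 ?_⟩
    rw [h₁]
    exact hSG _
  refine ⟨T, V, ?_, fun x => hSG x, fun x => ?_, htraj⟩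
  · -- `T = (c - A)⁻¹ (c T - A T)`
    have : (T : H → H) = R ∘ ((c : ℂ) • T - V) := by
      ext x
      exact (hR.mem_iff _ _).1 (hSG x)
    rw [this]
    exact hRc.comp_clm _
  · -- differentiate `S (T x) t = S x (t + 1) = T (S x t)` at `t = 1`
    have h₁ : EqOn (S (T x)) (fun t => T (S x t)) (Ici 0) := by
      intro t ht
      have h₂ := (hS (T x)).eqOn h ((hS x).shift zero_le_one) (by simp [hS0, hTapp]) ht
      exact h₂.trans (htraj _ (hS x) t ht).1
    have h₂ : S (T x) =ᶠ[𝓝 1] fun t => T (S x t) :=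
      Filter.mem_of_superset (Ici_mem_nhds one_pos) h₁
    rw [hVapp, h₂.deriv_eq]
    exact ((T.restrictScalars ℝ).hasFDerivAt.comp_hasDerivAt 1
      ((hS x).deriv_mem one_pos).1).deriv

/-- The spectral mapping theorem in the form needed here.  An eigenspace of the compact time-one map
is finite dimensional and invariant under the generator, which therefore has an eigenvector in it;
so every nonzero point of the spectrum of the time-one map is the exponential of an eigenvalue of the
generator. -/
lemma IsSectorial.exists_eigenvalue_of_mem_spectrum (h : IsSectorial G ω) {T V : H →L[ℂ] H}
    (hT : IsCompactOperator T) (hG : ∀ x, (T x, V x) ∈ G) (hTV : ∀ x, V (T x) = T (V x))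
    (htraj : ∀ u, IsTrajectory G u → ∀ t ≥ 0, u (t + 1) = T (u t) ∧ deriv u (t + 1) = V (u t))
    {l : ℂ} (hl : l ∈ spectrum ℂ T) (hl0 : l ≠ 0) :
    ∃ μ : ℂ, l = Complex.exp μ ∧ ∃ w ≠ 0, (w, μ • w) ∈ G := by
  obtain ⟨c, R, -, hR⟩ := h.exists_resolvent
  have hev : Module.End.HasEigenvalue (T : H →ₗ[ℂ] H) l :=
    (hT.hasEigenvalue_or_mem_resolventSet hl0).resolve_right hl
  set N : Submodule ℂ H := Module.End.eigenspace (T : H →ₗ[ℂ] H) l with hN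
  have hNmem : ∀ x, x ∈ N ↔ T x = l • x := fun x => Module.End.mem_eigenspace_iff
  have hNclosed : IsClosed (N : Set H) := by
    have : (N : Set H) = {x | T x = l • x} := by
      ext x; exact hNmem x
    rw [this]
    exact isClosed_eq T.continuous (continuous_const_smul l)
  have hTN : ∀ x ∈ N, (T : H →ₗ[ℂ] H) x ∈ N := fun x hx => by
    change T x ∈ N
    rw [(hNmem x).1 hx]
    exact N.smul_mem l hx
  have hfin : FiniteDimensional ℂ N := by
    have h₁ := (hT.restrict hTN hNclosed).smul l⁻¹
    refine FiniteDimensional.of_isCompactOperator_id (𝕜 := ℂ) (E := N) ?_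
    have h₂ : (l⁻¹ • ⇑((T : H →ₗ[ℂ] H).restrict hTN) : N → N) = id := by
      funext x
      apply Subtype.ext
      have := (hNmem x).1 x.2
      simp [this, smul_smul, hl0]
    rwa [h₂] at h₁
  have hnt : Nontrivial N := by
    rw [Submodule.nontrivial_iff_ne_bot]
    exact hev
  have hVN : ∀ x ∈ N, (V : H →ₗ[ℂ] H) x ∈ N := fun x hx => by
    rw [hNmem] at hx ⊢
    change T (V x) = l • V x
    rw [← hTV, hx, map_smul]
  obtain ⟨k, hk⟩ := Module.End.exists_eigenvalue ((V : H →ₗ[ℂ] H).restrict hVN)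
  obtain ⟨x, hx⟩ := hk.exists_hasEigenvector
  have hx0 : (x : H) ≠ 0 := by simpa using hx.2
  have hVx : V x = k • (x : H) := congrArg Subtype.val hx.apply_eq_smul
  have hTx : T x = l • (x : H) := (hNmem x).1 x.2
  have hxG : ((x : H), (l⁻¹ * k) • (x : H)) ∈ G := by
    have := hR.smul_mem l⁻¹ (hG x)
    rwa [hVx, hTx, smul_smul, smul_smul, inv_mul_cancel₀ hl0, one_smul] at this
  refine ⟨l⁻¹ * k, ?_, x, hx0, hxG⟩
  generalize l⁻¹ * k = μ at hxG
  -- `exp (μ t) x` is a trajectory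
  have hd : ∀ t : ℝ, HasDerivAt (fun t : ℝ => Complex.exp (μ * t) • (x : H))
      (Complex.exp (μ * t) • μ • (x : H)) t := by
    intro t
    have h₁ : HasDerivAt (fun t : ℝ => Complex.exp (μ * t)) (Complex.exp (μ * t) * μ) t := by
      simpa using (((hasDerivAt_id (t : ℂ)).const_mul μ).cexp).comp_ofReal
    rw [smul_smul]
    exact h₁.smul_const _
  have hu : IsTrajectory G fun t : ℝ => Complex.exp (μ * t) • (x : H) :=
    ⟨fun t _ => (hd t).continuousAt.continuousWithinAt,
      fun t _ => ⟨_, hd t, hR.smul_mem _ hxG⟩⟩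
  have := (htraj _ hu 0 le_rfl).1
  simp only [zero_add, Complex.ofReal_one, mul_one, Complex.ofReal_zero, mul_zero,
    Complex.exp_zero, one_smul] at this
  rw [hTx, ← sub_eq_zero, ← sub_smul] at this
  exact (sub_eq_zero.1 ((smul_eq_zero.1 this).resolve_right hx0)).symm

/-- A sectorial operator with compact resolvent whose eigenvalues lie in the open left half plane is
asymptotically stable, and the velocities of its trajectories tend to zero as well. -/
theorem IsSectorial.asymptoticallyStable (h : IsSectorial G ω)
    (hneg : ∀ (μ : ℂ) (w : H), w ≠ 0 → (w, μ • w) ∈ G → μ.re < 0) :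
    AsymptoticallyStable G ∧ ∀ u, IsTrajectory G u → Tendsto (deriv u) atTop (𝓝 0) := by
  obtain ⟨T, V, hT, hG, hTV, htraj⟩ := h.exists_timeOne
  obtain ⟨C, hC⟩ := h.exists_trajectory
  have hpow : Tendsto (fun n : ℕ => ‖T ^ n‖) atTop (𝓝 0) := by
    rcases subsingleton_or_nontrivial H with hH | hH
    · have : ∀ n : ℕ, T ^ n = 0 := fun n => Subsingleton.elim _ _
      simp [this]
    · refine tendsto_norm_pow_of_spectrum_lt T fun l hl => ?_
      rcases eq_or_ne l 0 with rfl | hl0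
      · simp
      · obtain ⟨μ, rfl, w, hw, hwG⟩ :=
          h.exists_eigenvalue_of_mem_spectrum hT hG hTV htraj hl hl0
        rw [Complex.norm_exp, Real.exp_lt_one_iff]
        exact hneg μ w hw hwG
  have hfloor : ∀ u, IsTrajectory G u → ∀ t ≥ 0,
      ‖u t‖ ≤ Real.exp ω * ‖T ^ ⌊t⌋₊‖ * ‖u 0‖ := by
    intro u hu t ht
    have hn : ∀ n : ℕ, u n = (T ^ n) (u 0) := by
      intro n
      induction n with
      | zero => simp
      | succ n ih =>
        rw [Nat.cast_succ, (htraj u hu n n.cast_nonneg).1, ih, pow_succ']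
        rfl
    have hs : 0 ≤ t - ⌊t⌋₊ := sub_nonneg.2 (Nat.floor_le ht)
    have hs1 : t - ⌊t⌋₊ ≤ 1 := by linarith [Nat.lt_floor_add_one t]
    have h₁ := (hu.shift (Nat.cast_nonneg ⌊t⌋₊)).norm_le h hs
    rw [sub_add_cancel, zero_add, hn] at h₁
    calc ‖u t‖ ≤ _ := h₁
      _ ≤ Real.exp (ω * 1) * (‖T ^ ⌊t⌋₊‖ * ‖u 0‖) := by
          gcongr
          · exact h.nonneg
          · exact ContinuousLinearMap.le_opNorm _ _
      _ = _ := by ring_nf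
  have htend : ∀ u, IsTrajectory G u → Tendsto u atTop (𝓝 0) := by
    intro u hu
    rw [tendsto_zero_iff_norm_tendsto_zero]
    have h₁ : Tendsto (fun t : ℝ => Real.exp ω * ‖T ^ ⌊t⌋₊‖ * ‖u 0‖) atTop (𝓝 0) := by
      have := ((hpow.comp (tendsto_nat_floor_atTop (α := ℝ))).const_mul (Real.exp ω)).mul_const
        ‖u 0‖
      simpa using this
    refine squeeze_zero' (.of_forall fun t => norm_nonneg _) ?_ h₁
    filter_upwards [eventually_ge_atTop 0] with t ht using hfloor u hu t ht
  refine ⟨⟨fun w => ?_, fun ε hε => ?_, htend⟩, fun u hu => ?_⟩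
  · obtain ⟨u, hu, hu0, -⟩ := hC w
    exact ⟨u, hu, hu0⟩
  · obtain ⟨M, hM⟩ := hpow.bddAbove_range
    have hM' : ∀ n, ‖T ^ n‖ ≤ M := fun n => hM ⟨n, rfl⟩
    have hM0 : 0 ≤ M := (norm_nonneg _).trans (hM' 0)
    refine ⟨ε / (Real.exp ω * (M + 1)), by positivity, fun u hu hu0 t ht => ?_⟩
    rw [lt_div_iff₀ (by positivity)] at hu0
    calc ‖u t‖ ≤ _ := hfloor u hu t ht
      _ ≤ Real.exp ω * (M + 1) * ‖u 0‖ := by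
          gcongr
          exact (hM' _).trans (by linarith)
      _ < ε := by rwa [mul_comm]
  · have h₁ : Tendsto (fun t : ℝ => V (u (t - 1))) atTop (𝓝 0) := by
      have := (htend u hu).comp (tendsto_atTop_add_const_right atTop (-1 : ℝ) tendsto_id)
      simpa [Function.comp_def, sub_eq_add_neg] using (V.continuous.tendsto 0).comp this
    refine h₁.congr' ?_
    filter_upwards [eventually_ge_atTop 1] with t ht
    have := (htraj u hu (t - 1) (by linarith)).2
    rw [sub_add_cancel] at this
    exact this.symm

end Stability

/-! ### Continuous profiles and the Volterra operator -/

/-- Continuous temperature profiles on `[0,1]`. -/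
abbrev Prof : Type := C(unitInterval, ℂ)

/-- The profile as a function on `ℝ`, extended by its end values. -/
def ext (Z : Prof) : ℝ → ℂ := IccExtend zero_le_one Z

lemma continuous_ext (Z : Prof) : Continuous (ext Z) := Z.continuous.Icc_extend'

lemma ext_of_mem (Z : Prof) {x : ℝ} (hx : x ∈ Icc (0 : ℝ) 1) : ext Z x = Z ⟨x, hx⟩ :=
  IccExtend_of_mem _ _ hx

@[simp] lemma ext_coe (Z : Prof) (x : unitInterval) : ext Z x = Z x := ext_of_mem Z x.2

lemma norm_ext_le (Z : Prof) (x : ℝ) : ‖ext Z x‖ ≤ ‖Z‖ := Z.norm_coe_le_norm _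

lemma memLp_ext (Z : Prof) : MemLp (ext Z) 2 (volume.restrict (Icc (0 : ℝ) 1)) :=
  MemLp.of_bound (continuous_ext Z).aestronglyMeasurable ‖Z‖ (.of_forall (norm_ext_le Z))

/-- The embedding of `C[0,1]` into `L²(0,1)`. -/
def toState : Prof →L[ℂ] State :=
  LinearMap.mkContinuous
    { toFun := fun Z => (memLp_ext Z).toLp (ext Z)
      map_add' := fun _ _ => rfl
      map_smul' := fun _ _ => rfl } 1 fun Z => by
    have h : ∀ᵐ x ∂(volume.restrict (Icc (0 : ℝ) 1)), ‖(memLp_ext Z).toLp (ext Z) x‖ ≤ ‖Z‖ := by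
      filter_upwards [(memLp_ext Z).coeFn_toLp] with x hx
      rw [hx]
      exact norm_ext_le Z x
    refine (Lp.norm_le_of_ae_bound (norm_nonneg Z) h).trans_eq ?_
    simp [measureUnivNNReal]

lemma coeFn_toState (Z : Prof) : toState Z =ᵐ[volume.restrict (Icc (0 : ℝ) 1)] ext Z :=
  (memLp_ext Z).coeFn_toLp

lemma represents_ext (Z : Prof) : Represents (ext Z) (toState Z) :=
  ⟨(continuous_ext Z).continuousOn, coeFn_toState Z⟩

lemma Represents.eqOn {Z Z' : ℝ → ℂ} {z : State} (h : Represents Z z) (h' : Represents Z' z) :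
    EqOn Z Z' (Icc 0 1) :=
  MeasureTheory.Measure.eqOn_Icc_of_ae_eq volume zero_ne_one
    (by filter_upwards [h.2, h'.2] with x h₁ h₂; rw [← h₁, h₂]) h.1 h'.1

lemma Represents.exists_prof {Z : ℝ → ℂ} {z : State} (h : Represents Z z) :
    ∃ W : Prof, EqOn Z (ext W) (Icc 0 1) ∧ toState W = z := by
  have h₁ : EqOn Z (ext ⟨(Icc (0 : ℝ) 1).domRestrict Z, h.1.domRestrict⟩) (Icc 0 1) := fun x hx => by
    rw [ext_of_mem _ hx]; rfl
  refine ⟨_, h₁, Lp.ext ?_⟩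
  filter_upwards [coeFn_toState ⟨(Icc (0 : ℝ) 1).domRestrict Z, h.1.domRestrict⟩, h.2,
    ae_restrict_mem measurableSet_Icc] with x h₂ h₃ h₄
  rw [h₂, h₃, h₁ h₄]

lemma toState_injective : Function.Injective toState := by
  intro Z W h
  ext x
  have := (represents_ext Z).eqOn (h ▸ represents_ext W) x.2
  simpa using this

/-- The indicator function of the interval `(a, b]` as a state. -/
def box (a b : ℝ) : State :=
  indicatorConstLp 2 (measurableSet_Ioc (a := a) (b := b)) (measure_ne_top _ _) (1 : ℂ)

lemma coeFn_box (a b : ℝ) :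
    box a b =ᵐ[volume.restrict (Icc (0 : ℝ) 1)] (Ioc a b).indicator fun _ => (1 : ℂ) :=
  indicatorConstLp_coeFn

lemma restrict_Ioc {a b : ℝ} (ha : 0 ≤ a) (hb : b ≤ 1) :
    (volume.restrict (Icc (0 : ℝ) 1)).restrict (Ioc a b) = volume.restrict (Ioc a b) :=
  Measure.restrict_restrict_of_subset fun _ hx => ⟨ha.trans hx.1.le, hx.2.trans hb⟩

lemma inner_box {a b : ℝ} (ha : 0 ≤ a) (hab : a ≤ b) (hb : b ≤ 1) (f : State) :
    inner ℂ (box a b) f = ∫ x in a..b, f x := by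
  rw [box, L2.inner_indicatorConstLp_one, restrict_Ioc ha hb, intervalIntegral.integral_of_le hab]

lemma norm_box {a b : ℝ} (ha : 0 ≤ a) (hab : a ≤ b) (hb : b ≤ 1) : ‖box a b‖ = √(b - a) := by
  rw [box, norm_indicatorConstLp (by simp) (by simp), measureReal_def,
    Measure.restrict_apply measurableSet_Ioc, inter_eq_left.2
      (Ioc_subset_Icc_self.trans (Icc_subset_Icc ha hb)), Real.volume_Ioc,
    ENNReal.toReal_ofReal (sub_nonneg.2 hab), Real.sqrt_eq_rpow]
  simp

lemma box_sub_box {a b : ℝ} (ha : 0 ≤ a) (hab : a ≤ b) : box 0 b - box 0 a = box a b := by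
  apply Lp.ext
  filter_upwards [Lp.coeFn_sub (box 0 b) (box 0 a), coeFn_box 0 b, coeFn_box 0 a, coeFn_box a b]
    with x h₁ h₂ h₃ h₄
  rw [h₁, Pi.sub_apply, h₂, h₃, h₄]
  by_cases h₅ : x ≤ a
  · by_cases h₆ : 0 < x <;> simp [indicator, h₅, h₅.trans hab, h₆, not_lt.2 h₅]
  · have h₇ : 0 < x := ha.trans_lt (not_le.1 h₅)
    simp [indicator, h₅, h₇, not_le.1 h₅]

lemma integrableOn_state (f : State) : IntegrableOn f (Icc (0 : ℝ) 1) :=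
  (Lp.memLp f).integrable one_le_two

lemma intervalIntegrable_state (f : State) {a b : ℝ} (ha : a ∈ Icc (0 : ℝ) 1)
    (hb : b ∈ Icc (0 : ℝ) 1) : IntervalIntegrable f volume a b :=
  ((integrableOn_state f).mono_set (ordConnected_Icc.uIcc_subset ha hb)).intervalIntegrable

/-- The Volterra operator `f ↦ ∫₀ˣ f`, from `L²(0,1)` to `C[0,1]`. -/
def primitive : State →L[ℂ] Prof :=
  LinearMap.mkContinuous
    { toFun := fun f =>
        { toFun := fun x => inner ℂ (box 0 x) f
          continuous_toFun := by
            have hbox : Continuous fun x : unitInterval => box 0 x := by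
              have hle : ∀ x y : unitInterval, ‖box 0 y - box 0 x‖ ≤ √(dist x y) := by
                intro x y
                rcases le_total x y with h | h
                · rw [box_sub_box x.2.1 h, norm_box x.2.1 h y.2.2, Subtype.dist_eq, dist_comm,
                    Real.dist_eq, abs_of_nonneg (sub_nonneg.2 (show (x : ℝ) ≤ y from h))]
                · rw [norm_sub_rev, box_sub_box y.2.1 h, norm_box y.2.1 h x.2.2, Subtype.dist_eq,
                    Real.dist_eq, abs_of_nonneg (sub_nonneg.2 (show (y : ℝ) ≤ x from h))]
              rw [continuous_iff_continuousAt]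
              intro x
              rw [ContinuousAt, tendsto_iff_norm_sub_tendsto_zero]
              refine squeeze_zero (fun _ => norm_nonneg _) (fun y => hle x y) ?_
              have : Continuous fun y => √(dist x y) := by fun_prop
              simpa using this.tendsto x
            fun_prop }
      map_add' := fun f g => by ext x; exact inner_add_right (𝕜 := ℂ) (box 0 x) f g
      map_smul' := fun c f => by ext x; exact inner_smul_right (𝕜 := ℂ) (box 0 x) f c } 1 fun f => by
    rw [one_mul, ContinuousMap.norm_le _ (norm_nonneg f)]
    intro x
    refine (norm_inner_le_norm _ _).trans (mul_le_of_le_one_left (norm_nonneg f) ?_)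
    rw [norm_box le_rfl x.2.1 x.2.2, Real.sqrt_le_one]
    linarith [x.2.2]

lemma primitive_apply (f : State) (x : unitInterval) : primitive f x = inner ℂ (box 0 x) f := rfl

lemma primitive_eq_integral (f : State) (x : unitInterval) :
    primitive f x = ∫ s in (0 : ℝ)..x, f s := inner_box le_rfl x.2.1 x.2.2 f

@[simp] lemma primitive_zero (f : State) : primitive f 0 = 0 := by
  simp [primitive_eq_integral]

lemma inner_box_eq_sub (f : State) {a b : unitInterval} (hab : a ≤ b) :
    inner ℂ (box a b) f = primitive f b - primitive f a := by
  rw [primitive_apply, primitive_apply, ← inner_sub_left, box_sub_box a.2.1 hab]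

lemma norm_primitive_sub_le (f : State) (x y : unitInterval) :
    ‖primitive f x - primitive f y‖ ≤ √(dist x y) * ‖f‖ := by
  wlog h : y ≤ x generalizing x y
  · rw [norm_sub_rev, dist_comm]
    exact this y x (le_of_not_ge h)
  rw [← inner_box_eq_sub f h]
  refine (norm_inner_le_norm _ _).trans_eq ?_
  rw [norm_box y.2.1 h x.2.2, Subtype.dist_eq, Real.dist_eq, abs_of_nonneg (sub_nonneg.2 (show (y : ℝ) ≤ x from h))]

/-- By the Arzelà–Ascoli theorem, the Volterra operator is compact: primitives of a bounded set of
states are uniformly Hölder continuous of exponent `1/2`. -/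
lemma isCompactOperator_primitive : IsCompactOperator primitive := by
  let e := ContinuousMap.isometryEquivBoundedOfCompact unitInterval ℂ
  set A : Set (BoundedContinuousFunction unitInterval ℂ) :=
    e '' (primitive '' Metric.closedBall 0 1) with hA
  have hcomp : IsCompact (closure A) := by
    refine BoundedContinuousFunction.arzela_ascoli (Metric.closedBall 0 1)
      (isCompact_closedBall 0 1) A ?_ ?_
    · rintro _ x ⟨_, ⟨f, hf, rfl⟩, rfl⟩
      rw [mem_closedBall_zero_iff] at hf ⊢
      have := norm_primitive_sub_le f x 0
      rw [primitive_zero, sub_zero] at this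
      refine this.trans (mul_le_one₀ ?_ (norm_nonneg f) hf)
      rw [Real.sqrt_le_one, Subtype.dist_eq, Real.dist_eq]
      simpa [abs_of_nonneg x.2.1] using x.2.2
    · refine Metric.equicontinuous_of_continuity_modulus (fun t => √t) ?_ _ ?_
      · have : Continuous fun t : ℝ => √t := Real.continuous_sqrt
        simpa using this.tendsto 0
      · rintro x y ⟨_, _, ⟨f, hf, rfl⟩, rfl⟩
        rw [mem_closedBall_zero_iff] at hf
        change dist (primitive f x) (primitive f y) ≤ _
        rw [dist_eq_norm]
        exact (norm_primitive_sub_le f x y).trans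
          (mul_le_of_le_one_right (Real.sqrt_nonneg _) hf)
  refine ⟨e.symm '' closure A, hcomp.image e.symm.continuous, ?_⟩
  refine Filter.mem_of_superset (Metric.closedBall_mem_nhds 0 one_pos) fun f hf => ?_
  exact ⟨e (primitive f), subset_closure ⟨_, ⟨f, hf, rfl⟩, rfl⟩, e.symm_apply_apply _⟩

lemma primitive_injective : Function.Injective primitive := by
  rw [injective_iff_map_eq_zero]
  intro f hf
  have h₀ : ∀ x ∈ Icc (0 : ℝ) 1, ∫ s in (0 : ℝ)..x, f s = 0 := fun x hx => by
    rw [← primitive_eq_integral f ⟨x, hx⟩, hf]; rfl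
  have h₁ := (intervalIntegrable_state f (left_mem_Icc.2 zero_le_one)
    (right_mem_Icc.2 zero_le_one)).ae_hasDerivAt_integral
  apply Lp.ext
  have h₂ : ∀ᵐ x ∂(volume.restrict (Icc (0 : ℝ) 1)), x ∈ Ioo (0 : ℝ) 1 := by
    rw [← restrict_Ioo_eq_restrict_Icc]
    exact ae_restrict_mem measurableSet_Ioo
  filter_upwards [ae_restrict_of_ae h₁, h₂, Lp.coeFn_zero ℂ 2 (volume.restrict (Icc (0 : ℝ) 1))]
    with x h₃ h₄ h₅
  rw [h₅, Pi.zero_apply]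
  have h₆ := h₃ (by rw [uIcc_of_le zero_le_one]; exact Ioo_subset_Icc_self h₄) 0 (by simp)
  have h₇ : (fun x => ∫ s in (0 : ℝ)..x, f s) =ᶠ[𝓝 x] fun _ => 0 := by
    filter_upwards [Ioo_mem_nhds h₄.1 h₄.2] with y hy using h₀ y (Ioo_subset_Icc_self hy)
  exact h₆.unique ((hasDerivAt_const x (0 : ℂ)).congr_of_eventuallyEq h₇)

/-- Integration by parts: the adjoint of the Volterra operator is its negative up to a rank-one
boundary term.  It suffices to check this on the dense set of continuous functions. -/
lemma inner_primitive_add (f g : State) :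
    inner ℂ (toState (primitive f)) g + inner ℂ f (toState (primitive g)) =
      starRingEnd ℂ (primitive f 1) * primitive g 1 := by
  have hdense := BoundedContinuousFunction.toLp_denseRange (α := ℝ) (E := ℂ) (p := 2)
    (volume.restrict (Icc (0 : ℝ) 1)) ℂ (by simp)
  refine hdense.induction_on₂ (p := fun f g : State =>
    inner ℂ (toState (primitive f)) g + inner ℂ f (toState (primitive g)) =
      starRingEnd ℂ (primitive f 1) * primitive g 1) ?_ ?_ f g
  · have h : Continuous fun f : State => primitive f 1 := by
      exact (continuous_eval_const (F := Prof) (1 : unitInterval)).comp primitive.continuous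
    exact isClosed_eq (by fun_prop) (((Complex.continuous_conj.comp h).comp continuous_fst).mul
      (h.comp continuous_snd))
  · clear f g
    intro φ ψ
    have hφ := BoundedContinuousFunction.coeFn_toLp (p := 2) (𝕜 := ℂ)
      (volume.restrict (Icc (0 : ℝ) 1)) φ
    have hψ := BoundedContinuousFunction.coeFn_toLp (p := 2) (𝕜 := ℂ)
      (volume.restrict (Icc (0 : ℝ) 1)) ψ
    set f : State := BoundedContinuousFunction.toLp 2 (volume.restrict (Icc (0 : ℝ) 1)) ℂ φ
    set g : State := BoundedContinuousFunction.toLp 2 (volume.restrict (Icc (0 : ℝ) 1)) ℂ ψ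
    have hprim : ∀ (χ : BoundedContinuousFunction ℝ ℂ) (k : State),
        k =ᵐ[volume.restrict (Icc (0 : ℝ) 1)] χ → ∀ x : unitInterval,
        primitive k x = ∫ s in (0 : ℝ)..x, χ s := by
      intro χ k hk x
      rw [primitive_eq_integral]
      refine intervalIntegral.integral_congr_ae ?_
      filter_upwards [(ae_restrict_iff' measurableSet_Icc).1 hk] with s hs hs'
      rw [uIoc_of_le x.2.1] at hs'
      exact hs ⟨hs'.1.le, hs'.2.trans x.2.2⟩
    set Φ : ℝ → ℂ := fun x => ∫ s in (0 : ℝ)..x, φ s with hΦ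
    set Ψ : ℝ → ℂ := fun x => ∫ s in (0 : ℝ)..x, ψ s with hΨ
    have hΦd : ∀ x, HasDerivAt Φ (φ x) x := fun x => φ.continuous.integral_hasStrictDerivAt 0 x
      |>.hasDerivAt
    have hΨd : ∀ x, HasDerivAt Ψ (ψ x) x := fun x => ψ.continuous.integral_hasStrictDerivAt 0 x
      |>.hasDerivAt
    have hΦc : Continuous Φ := continuous_iff_continuousAt.2 fun x => (hΦd x).continuousAt
    have hΨc : Continuous Ψ := continuous_iff_continuousAt.2 fun x => (hΨd x).continuousAt
    have h₁ : inner ℂ (toState (primitive f)) g = ∫ x in (0 : ℝ)..1, starRingEnd ℂ (Φ x) * ψ x := by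
      rw [L2.inner_def, intervalIntegral.integral_of_le zero_le_one, ← integral_Icc_eq_integral_Ioc]
      refine integral_congr_ae ?_
      filter_upwards [hψ, coeFn_toState (primitive f), ae_restrict_mem measurableSet_Icc]
        with x h₂ h₃ h₄
      rw [h₂, h₃, ext_of_mem _ h₄, hprim φ f hφ, RCLike.inner_apply, mul_comm]
    have h₂ : inner ℂ f (toState (primitive g)) = ∫ x in (0 : ℝ)..1, starRingEnd ℂ (φ x) * Ψ x := by
      rw [L2.inner_def, intervalIntegral.integral_of_le zero_le_one, ← integral_Icc_eq_integral_Ioc]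
      refine integral_congr_ae ?_
      filter_upwards [hφ, coeFn_toState (primitive g), ae_restrict_mem measurableSet_Icc]
        with x h₂ h₃ h₄
      rw [h₂, h₃, ext_of_mem _ h₄, hprim ψ g hψ, RCLike.inner_apply, mul_comm]
    have hcΦ : ∀ x, HasDerivAt (fun x => starRingEnd ℂ (Φ x)) (starRingEnd ℂ (φ x)) x := fun x =>
      (hΦd x).star
    have h₃ := intervalIntegral.integral_deriv_mul_eq_sub (a := 0) (b := 1) (fun x _ => hcΦ x)
      (fun x _ => hΨd x)
      ((Complex.continuous_conj.comp φ.continuous).intervalIntegrable 0 1)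
      (ψ.continuous.intervalIntegrable 0 1)
    rw [h₁, h₂, ← intervalIntegral.integral_add, hprim φ f hφ 1, hprim ψ g hψ 1]
    · have h₄ : Φ 0 = 0 := intervalIntegral.integral_same
      simp only [h₄, map_zero, zero_mul, sub_zero] at h₃
      rw [Icc.coe_one, ← h₃]
      congr 1
      ext x
      rw [add_comm]
    · exact ((Complex.continuous_conj.comp hΦc).mul ψ.continuous).intervalIntegrable 0 1
    · exact ((Complex.continuous_conj.comp φ.continuous).mul hΨc).intervalIntegrable 0 1

/-- An interpolation inequality: the supremum of a profile with derivative `D` is controlled by an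
arbitrarily small multiple of `‖D‖` and a large multiple of the norm of the profile in `L²`. -/
lemma norm_prof_le {Z : Prof} {D : State}
    (hZ : ∀ x, Z x = Z 0 + primitive D x) {t : ℝ} (ht : 0 < t) (ht1 : t ≤ 1) :
    ‖Z‖ ≤ ‖toState Z‖ / t + t * ‖D‖ := by
  rw [ContinuousMap.norm_le _ (by positivity)]
  intro x
  have hx := x.2
  have ht2 : t ^ 2 ≤ 1 := pow_le_one₀ ht.le ht1
  -- an interval of length `t²` in `[0,1]` that contains `x`
  obtain ⟨a, ha, hax, hxb, hb⟩ : ∃ a : ℝ, 0 ≤ a ∧ a ≤ x ∧ x ≤ a + t ^ 2 ∧ a + t ^ 2 ≤ 1 := by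
    refine ⟨min x (1 - t ^ 2), le_min hx.1 (by linarith), min_le_left _ _, ?_, ?_⟩
    · rcases min_choice (x : ℝ) (1 - t ^ 2) with h | h <;> rw [h] <;> nlinarith [hx.2]
    · linarith [min_le_right (x : ℝ) (1 - t ^ 2)]
  have hab : a ≤ a + t ^ 2 := by nlinarith
  have h₁ : ∫ s in a..(a + t ^ 2), ext Z s = inner ℂ (box a (a + t ^ 2)) (toState Z) := by
    rw [inner_box ha hab hb]
    refine intervalIntegral.integral_congr_ae ?_
    filter_upwards [(ae_restrict_iff' measurableSet_Icc).1 (coeFn_toState Z)] with s hs hs'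
    rw [uIoc_of_le hab] at hs'
    exact (hs ⟨ha.trans hs'.1.le, hs'.2.trans hb⟩).symm
  have h₂ : ‖∫ s in a..(a + t ^ 2), (Z x - ext Z s)‖ ≤ (t * ‖D‖) * |a + t ^ 2 - a| := by
    refine intervalIntegral.norm_integral_le_of_norm_le_const fun s hs => ?_
    rw [uIoc_of_le hab] at hs
    have hs' : s ∈ Icc (0 : ℝ) 1 := ⟨ha.trans hs.1.le, hs.2.trans hb⟩
    rw [ext_of_mem _ hs', hZ x, hZ ⟨s, hs'⟩, add_sub_add_left_eq_sub]
    refine (norm_primitive_sub_le D _ _).trans ?_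
    gcongr
    rw [Real.sqrt_le_left ht.le, Subtype.dist_eq, Real.dist_eq, abs_le]
    constructor <;> linarith [hs.1, hs.2]
  have h₃ : ∫ s in a..(a + t ^ 2), (Z x - ext Z s) =
      ((t ^ 2 : ℝ) : ℂ) * Z x - inner ℂ (box a (a + t ^ 2)) (toState Z) := by
    rw [intervalIntegral.integral_sub (by simp)
      ((continuous_ext Z).intervalIntegrable _ _), h₁, intervalIntegral.integral_const]
    simp
  have h₄ : ‖inner ℂ (box a (a + t ^ 2)) (toState Z)‖ ≤ t * ‖toState Z‖ := by
    refine (norm_inner_le_norm _ _).trans_eq ?_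
    rw [norm_box ha hab hb, add_sub_cancel_left, Real.sqrt_sq ht.le]
  rw [h₃, add_sub_cancel_left, abs_of_nonneg (by positivity)] at h₂
  have h₅ : t ^ 2 * ‖Z x‖ ≤ t * ‖toState Z‖ + t * ‖D‖ * t ^ 2 := by
    have h₆ := norm_sub_norm_le (((t ^ 2 : ℝ) : ℂ) * Z x)
      (inner ℂ (box a (a + t ^ 2)) (toState Z))
    rw [norm_mul, Complex.norm_real, Real.norm_of_nonneg (by positivity)] at h₆
    linarith
  have h₆ : t ^ 2 * ‖Z x‖ ≤ t ^ 2 * (‖toState Z‖ / t + t * ‖D‖) := by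
    refine h₅.trans_eq ?_
    field_simp
  exact le_of_mul_le_mul_left h₆ (by positivity)

/-! ### Rods with point fluxes in integrated form -/

section Integrated

variable {n : ℕ} {η : Fin n → ℝ} {c : Fin n → ℂ}

/-- The derivative `∫₀ˣ F - ∑ i, c i · 1_{x > η i}` of a profile with second derivative `F` and fluxes
`c i` at the points `η i`. -/
def slope (η : Fin n → ℝ) (c : Fin n → ℂ) (F : State) : State :=
  toState (primitive F) - ∑ i, c i • box (η i) 1

/-- The integrated form of `IsProfile (pointFlux η c) Z F`: the profile `Z` is a primitive of
`slope η c F`, and the total flux balances `∫ F`. -/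
def IsSolution (η : Fin n → ℝ) (c : Fin n → ℂ) (F : State) (Z : Prof) : Prop :=
  primitive F 1 = ∑ i, c i ∧ ∀ x, Z x = Z 0 + primitive (slope η c F) x

/-- The sum of the fluxes strictly to the left of `x`. -/
def fluxStep (η : Fin n → ℝ) (c : Fin n → ℂ) (x : ℝ) : ℂ := ∑ i, if η i < x then c i else 0

lemma fluxStep_eq_zero (hη : ∀ i, η i ∈ Icc (0 : ℝ) 1) {x : ℝ} (hx : x ≤ 0) :
    fluxStep η c x = 0 :=
  Finset.sum_eq_zero fun i _ => if_neg (not_lt.2 (hx.trans (hη i).1))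

lemma fluxStep_eq_sum (hη : ∀ i, η i ∈ Icc (0 : ℝ) 1) {x : ℝ} (hx : 1 < x) :
    fluxStep η c x = ∑ i, c i :=
  Finset.sum_congr rfl fun i _ => if_pos ((hη i).2.trans_lt hx)

lemma tendsto_fluxStep_left (x : ℝ) : Tendsto (fluxStep η c) (𝓝[<] x) (𝓝 (fluxStep η c x)) := by
  refine tendsto_finsetSum _ fun i _ => tendsto_const_nhds.congr' ?_
  by_cases h : η i < x
  · filter_upwards [Ioo_mem_nhdsLT h] with y hy
    rw [if_pos h, if_pos hy.1]
  · filter_upwards [self_mem_nhdsWithin] with y hy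
    rw [if_neg h, if_neg (not_lt.2 ((le_of_lt hy).trans (not_lt.1 h)))]

lemma tendsto_fluxStep_right (x : ℝ) :
    Tendsto (fluxStep η c) (𝓝[>] x) (𝓝 (fluxStep η c x + pointFlux η c x)) := by
  rw [fluxStep, pointFlux, ← Finset.sum_add_distrib]
  refine tendsto_finsetSum _ fun i _ => tendsto_const_nhds.congr' ?_
  rcases lt_trichotomy (η i) x with h | h | h
  · filter_upwards [self_mem_nhdsWithin] with y hy
    simp [h, h.trans hy, h.ne']
  · filter_upwards [self_mem_nhdsWithin] with y hy
    have hy : x < y := hy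
    simp [h, hy]
  · filter_upwards [Ioo_mem_nhdsGT h] with y hy
    simp [not_lt.2 h.le, not_lt.2 hy.2.le, h.ne]

lemma fluxStep_eq_of_disjoint {a b : ℝ} (hab : a ≤ b) (h : ∀ i, η i ∉ Icc a b) :
    fluxStep η c a = fluxStep η c b := by
  refine Finset.sum_congr rfl fun i _ => ?_
  by_cases h₁ : η i < a
  · rw [if_pos h₁, if_pos (h₁.trans_le hab)]
  · rw [if_neg h₁, if_neg fun h₂ => h i ⟨not_lt.1 h₁, h₂.le⟩]

lemma measurable_fluxStep : Measurable (fluxStep η c) :=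
  Finset.measurable_sum _ fun _ _ =>
    Measurable.ite (measurableSet_lt measurable_const measurable_id) measurable_const
      measurable_const

lemma coeFn_slope (F : State) : slope η c F =ᵐ[volume.restrict (Icc (0 : ℝ) 1)]
    fun x => ext (primitive F) x - fluxStep η c x := by
  have h : ∀ s : Finset (Fin n), (∑ i ∈ s, c i • box (η i) 1 : State)
      =ᵐ[volume.restrict (Icc (0 : ℝ) 1)] fun x => ∑ i ∈ s, if η i < x then c i else 0 := by
    classical
    intro s
    induction s using Finset.induction_on with
    | empty =>
      simp only [Finset.sum_empty]
      exact Lp.coeFn_zero _ _ _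
    | insert i s hi ih =>
      simp only [Finset.sum_insert hi]
      filter_upwards [ih, Lp.coeFn_add (c i • box (η i) 1) (∑ j ∈ s, c j • box (η j) 1),
        Lp.coeFn_smul (c i) (box (η i) 1), coeFn_box (η i) 1,
        ae_restrict_mem measurableSet_Icc] with x h₁ h₂ h₃ h₄ h₅
      rw [h₂, Pi.add_apply, h₁, h₃, Pi.smul_apply, h₄]
      congr 1
      by_cases h : η i < x <;> simp [indicator, h, h₅.2]
  filter_upwards [h Finset.univ, coeFn_toState (primitive F),
    Lp.coeFn_sub (toState (primitive F)) (∑ i, c i • box (η i) 1)] with x h₁ h₂ h₃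
  rw [slope, h₃, Pi.sub_apply, h₁, h₂]
  rfl

lemma intervalIntegrable_slope (F : State) {a b : ℝ} (ha : a ∈ Icc (0 : ℝ) 1)
    (hb : b ∈ Icc (0 : ℝ) 1) :
    IntervalIntegrable (fun x => ext (primitive F) x - fluxStep η c x) volume a b := by
  refine (intervalIntegrable_state (slope η c F) ha hb).congr_ae ?_
  exact ae_restrict_of_ae_restrict_of_subset
    (uIoc_subset_uIcc.trans (ordConnected_Icc.uIcc_subset ha hb)) (coeFn_slope F)

lemma primitive_slope (F : State) (x : unitInterval) : primitive (slope η c F) x =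
    ∫ s in (0 : ℝ)..x, (ext (primitive F) s - fluxStep η c s) := by
  rw [primitive_eq_integral]
  refine intervalIntegral.integral_congr_ae ?_
  filter_upwards [(ae_restrict_iff' measurableSet_Icc).1 (coeFn_slope (η := η) (c := c) F)]
    with s hs hs'
  rw [uIoc_of_le x.2.1] at hs'
  exact hs ⟨hs'.1.le, hs'.2.trans x.2.2⟩

lemma ext_primitive_sub (F : State) {a b : ℝ} (ha : a ∈ Icc (0 : ℝ) 1) (hb : b ∈ Icc (0 : ℝ) 1) :
    ext (primitive F) b - ext (primitive F) a = ∫ x in a..b, F x := by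
  have h0 : (0 : ℝ) ∈ Icc (0 : ℝ) 1 := by simp
  rw [ext_of_mem _ ha, ext_of_mem _ hb, primitive_eq_integral, primitive_eq_integral,
    intervalIntegral.integral_interval_sub_left (intervalIntegrable_state F h0 hb)
      (intervalIntegrable_state F h0 ha)]

lemma ext_primitive_of_nonpos (F : State) {x : ℝ} (hx : x ≤ 0) : ext (primitive F) x = 0 := by
  rw [ext, IccExtend_of_le_left _ _ hx]
  exact primitive_zero F

lemma ext_primitive_of_one_le (F : State) {x : ℝ} (hx : 1 ≤ x) :
    ext (primitive F) x = primitive F 1 :=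
  IccExtend_of_right_le _ _ hx

/-- A solution of the integrated problem is a profile. -/
lemma IsSolution.isProfile (hη : ∀ i, η i ∈ Icc (0 : ℝ) 1) {F : State} {W : Prof}
    (h : IsSolution η c F W) : IsProfile (pointFlux η c) (ext W) F := by
  refine ⟨(continuous_ext W).continuousOn, Finset.univ.image η,
    fun x => ext (primitive F) x - fluxStep η c x, ?_, ?_, ?_, ?_⟩
  · intro x hx hxS
    have hxS : ∀ i, x ≠ η i := fun i hi => hxS (by simp [hi])
    have hstep : Tendsto (fluxStep η c) (𝓝 x) (𝓝 (fluxStep η c x)) := by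
      refine tendsto_finsetSum _ fun i _ => tendsto_const_nhds.congr' ?_
      rcases lt_or_gt_of_ne (hxS i) with hi | hi
      · filter_upwards [Iio_mem_nhds hi] with y hy
        rw [if_neg (not_lt.2 hi.le), if_neg (not_lt.2 (le_of_lt hy))]
      · filter_upwards [Ioi_mem_nhds hi] with y hy
        rw [if_pos hi, if_pos (show η i < y from hy)]
    have h₁ := intervalIntegral.integral_hasDerivAt_right
      (intervalIntegrable_slope (η := η) (c := c) F (left_mem_Icc.2 zero_le_one)
        (Ioo_subset_Icc_self hx))
      (((continuous_ext (primitive F)).measurable.sub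
        measurable_fluxStep).stronglyMeasurable.stronglyMeasurableAtFilter)
      ((continuous_ext (primitive F)).continuousAt.sub hstep)
    refine (h₁.const_add (W 0)).congr_of_eventuallyEq ?_
    filter_upwards [Ioo_mem_nhds hx.1 hx.2] with y hy
    rw [ext_of_mem W (Ioo_subset_Icc_self hy), h.2, primitive_slope]
  · intro a b hab hsub
    have ha := hsub (left_mem_Icc.2 hab.le)
    have hb := hsub (right_mem_Icc.2 hab.le)
    have hst : fluxStep η c a = fluxStep η c b :=
      fluxStep_eq_of_disjoint hab.le fun i hi => (hsub hi).2 (by simp)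
    simp only [hst, sub_sub_sub_cancel_right]
    exact ext_primitive_sub F (Ioo_subset_Icc_self ha.1) (Ioo_subset_Icc_self hb.1)
  · intro x hx
    rcases lt_or_ge x 0 with h0 | h0
    · simp only [ext_primitive_of_nonpos F h0.le, fluxStep_eq_zero hη h0.le, sub_zero]
    · have h1 : 1 < x := not_le.1 fun h1 => hx ⟨h0, h1⟩
      simp only [ext_primitive_of_one_le F h1.le, fluxStep_eq_sum hη h1, h.1, sub_self]
  · intro x _
    have hP := (continuous_ext (primitive F)).tendsto x
    exact ⟨_, _, (hP.mono_left nhdsWithin_le_nhds).sub (tendsto_fluxStep_left x),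
      (hP.mono_left nhdsWithin_le_nhds).sub (tendsto_fluxStep_right x), by ring⟩

/-- A function that is constant on every interval missing the finite set `S`, and whose one-sided
limits agree at every point, is constant off `S`. -/
lemma eq_of_locally_const {Φ : ℝ → ℂ} (S : Finset ℝ)
    (hc : ∀ a b, a < b → Icc a b ⊆ (S : Set ℝ)ᶜ → Φ a = Φ b)
    (hl : ∀ x, ∃ l, Tendsto Φ (𝓝[<] x) (𝓝 l) ∧ Tendsto Φ (𝓝[>] x) (𝓝 l)) {x y : ℝ} (hx : x ∉ S)
    (hy : y ∉ S) : Φ x = Φ y := by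
  have hfin : ∀ x : ℝ, ∀ᶠ y in 𝓝[≠] x, y ∉ S := by
    intro x
    have : (((S.erase x : Finset ℝ) : Set ℝ))ᶜ ∈ 𝓝 x :=
      (S.erase x).finite_toSet.isClosed.isOpen_compl.mem_nhds (by simp)
    rw [eventually_nhdsWithin_iff]
    filter_upwards [this] with y hy hyx hyS
    exact hy (Finset.mem_coe.2 (Finset.mem_erase.2 ⟨hyx, hyS⟩))
  have hloc : ∀ x, ∃ k, ∀ᶠ y in 𝓝[≠] x, Φ y = k := by
    intro x
    obtain ⟨l, hl₁, hl₂⟩ := hl x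
    refine ⟨l, ?_⟩
    rw [← Iio_union_Ioi, nhdsWithin_union, eventually_sup]
    constructor
    · obtain ⟨a, ha, hsub⟩ := mem_nhdsLT_iff_exists_Ioo_subset.1
        ((hfin x).filter_mono (nhdsWithin_mono x fun y (hy : y < x) => hy.ne))
      have hconst : ∀ y ∈ Ioo a x, ∀ z ∈ Ioo a x, Φ y = Φ z := by
        intro y hy z hz
        wlog hyz : y < z generalizing y z
        · rcases eq_or_lt_of_le (not_lt.1 hyz) with h | h
          · rw [h]
          · exact (this z hz y hy h).symm
        exact hc y z hyz fun w hw => hsub ⟨hy.1.trans_le hw.1, hw.2.trans_lt hz.2⟩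
      filter_upwards [Ioo_mem_nhdsLT ha] with y hy
      refine tendsto_nhds_unique (tendsto_const_nhds.congr' ?_) hl₁
      filter_upwards [Ioo_mem_nhdsLT ha] with z hz using hconst y hy z hz
    · obtain ⟨a, ha, hsub⟩ := mem_nhdsGT_iff_exists_Ioo_subset.1
        ((hfin x).filter_mono (nhdsWithin_mono x fun y (hy : x < y) => hy.ne'))
      have hconst : ∀ y ∈ Ioo x a, ∀ z ∈ Ioo x a, Φ y = Φ z := by
        intro y hy z hz
        wlog hyz : y < z generalizing y z
        · rcases eq_or_lt_of_le (not_lt.1 hyz) with h | h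
          · rw [h]
          · exact (this z hz y hy h).symm
        exact hc y z hyz fun w hw => hsub ⟨hy.1.trans_le hw.1, hw.2.trans_lt hz.2⟩
      filter_upwards [Ioo_mem_nhdsGT ha] with y hy
      refine tendsto_nhds_unique (tendsto_const_nhds.congr' ?_) hl₂
      filter_upwards [Ioo_mem_nhdsGT ha] with z hz using hconst y hy z hz
  choose k hk using hloc
  have hklc : IsLocallyConstant k := by
    rw [IsLocallyConstant.iff_eventually_eq]
    intro x
    have h₁ := eventually_nhdsWithin_iff.1 (hk x)
    filter_upwards [eventually_eventually_nhds.2 h₁] with y hy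
    by_cases hyx : y = x
    · rw [hyx]
    · have h₂ : ∀ᶠ z in 𝓝 y, Φ z = k x := by
        filter_upwards [hy, isOpen_ne.mem_nhds hyx] with z hz hzx using hz hzx
      obtain ⟨z, hz₁, hz₂⟩ := ((hk y).and (h₂.filter_mono nhdsWithin_le_nhds)).exists
      rw [← hz₁, hz₂]
  have hkx : ∀ x, x ∉ S → Φ x = k x := by
    intro x hx
    have hnhds : ((S : Set ℝ))ᶜ ∈ 𝓝 x := S.finite_toSet.isClosed.isOpen_compl.mem_nhds hx
    obtain ⟨a, b, hab, hsub⟩ := mem_nhds_iff_exists_Ioo_subset.1 hnhds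
    obtain ⟨y, hy₁, hy₂⟩ := (((hk x).filter_mono (nhdsWithin_mono x
      fun y (hy : y ∈ Ioi x) => (ne_of_gt hy : y ≠ x))).and (Ioo_mem_nhdsGT hab.2)).exists
    rw [← hy₁]
    exact hc x y hy₂.1 fun w hw => hsub ⟨hab.1.trans_le hw.1, hw.2.trans_lt hy₂.2⟩
  rw [hkx x hx, hkx y hy, hklc.apply_eq_of_preconnectedSpace x y]

/-- A profile solves the integrated problem: its derivative and `slope` have the same jumps, so that
they agree. -/
lemma IsProfile.isSolution (hη : ∀ i, η i ∈ Icc (0 : ℝ) 1) {F : State} {W : Prof}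
    (h : IsProfile (pointFlux η c) (ext W) F) : IsSolution η c F W := by
  obtain ⟨-, S, dZ, hd, hint, hout, hlim⟩ := h
  set S' : Finset ℝ := S ∪ Finset.univ.image η ∪ {0, 1} with hS'
  have hS'mem : ∀ x, x ∉ S' ↔ (x ∉ S ∧ ∀ i, η i ≠ x) ∧ x ≠ 0 ∧ x ≠ 1 := by
    intro x
    simp only [hS', Finset.mem_union, Finset.mem_image, Finset.mem_univ, true_and,
      Finset.mem_insert, Finset.mem_singleton, not_or, not_exists]
  set Φ : ℝ → ℂ := fun x => dZ x - (ext (primitive F) x - fluxStep η c x) with hΦ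
  have hleft : ∀ x < 0, Φ x = 0 := fun x hx => by
    simp only [hΦ, hout x fun h => not_lt.2 h.1 hx, ext_primitive_of_nonpos F hx.le,
      fluxStep_eq_zero hη hx.le, sub_zero]
  have hright : ∀ x, 1 < x → Φ x = ∑ i, c i - primitive F 1 := fun x hx => by
    simp only [hΦ, hout x fun h => not_lt.2 h.2 hx, ext_primitive_of_one_le F hx.le,
      fluxStep_eq_sum hη hx]
    ring
  have hconst : ∀ a b, a < b → Icc a b ⊆ (S' : Set ℝ)ᶜ → Φ a = Φ b := by
    intro a b hab hsub
    have hsub' : ∀ x ∈ Icc a b, x ∉ S' := fun x hx => hsub hx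
    have h0 : (0 : ℝ) ∉ Icc a b := fun h => ((hS'mem 0).1 (hsub' 0 h)).2.1 rfl
    have h1 : (1 : ℝ) ∉ Icc a b := fun h => ((hS'mem 1).1 (hsub' 1 h)).2.2 rfl
    rcases lt_or_ge b 0 with hb | hb
    · rw [hleft a (hab.trans hb), hleft b hb]
    have ha0 : 0 < a := not_le.1 fun ha => h0 ⟨ha, hb⟩
    rcases lt_or_ge 1 a with ha | ha
    · rw [hright a ha, hright b (ha.trans hab)]
    have hb1 : b < 1 := not_le.1 fun hb => h1 ⟨ha, hb⟩
    have h₁ := hint a b hab fun x hx => ⟨⟨ha0.trans_le hx.1, hx.2.trans_lt hb1⟩,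
      ((hS'mem x).1 (hsub' x hx)).1.1⟩
    have h₂ := ext_primitive_sub F ⟨ha0.le, ha⟩ ⟨hb, hb1.le⟩
    have h₃ : fluxStep η c a = fluxStep η c b :=
      fluxStep_eq_of_disjoint hab.le fun i hi => ((hS'mem _).1 (hsub' _ hi)).1.2 i rfl
    rw [← h₂] at h₁
    simp only [hΦ, h₃]
    linear_combination -h₁
  have hlim' : ∀ x, ∃ l, Tendsto Φ (𝓝[<] x) (𝓝 l) ∧ Tendsto Φ (𝓝[>] x) (𝓝 l) := by
    intro x
    rcases lt_or_ge x 0 with hx | hx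
    · have : Φ =ᶠ[𝓝 x] fun _ => 0 := by
        filter_upwards [Iio_mem_nhds hx] with y hy using hleft y hy
      have h := (tendsto_congr' this).2 tendsto_const_nhds
      exact ⟨0, h.mono_left nhdsWithin_le_nhds, h.mono_left nhdsWithin_le_nhds⟩
    rcases lt_or_ge 1 x with hx1 | hx1
    · have : Φ =ᶠ[𝓝 x] fun _ => ∑ i, c i - primitive F 1 := by
        filter_upwards [Ioi_mem_nhds hx1] with y hy using hright y hy
      have h := (tendsto_congr' this).2 tendsto_const_nhds
      exact ⟨_, h.mono_left nhdsWithin_le_nhds, h.mono_left nhdsWithin_le_nhds⟩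
    obtain ⟨l, r, hl, hr, hlr⟩ := hlim x ⟨hx, hx1⟩
    have hP := (continuous_ext (primitive F)).tendsto x
    refine ⟨_, hl.sub ((hP.mono_left nhdsWithin_le_nhds).sub (tendsto_fluxStep_left x)), ?_⟩
    have := hr.sub ((hP.mono_left nhdsWithin_le_nhds).sub (tendsto_fluxStep_right (η := η) (c := c) x))
    convert this using 2
    linear_combination hlr
  -- to the left of the rod `Φ` vanishes, hence so does its constant value off `S'`
  obtain ⟨x₀, hx₀, hx₀S⟩ : ∃ x₀ < (0 : ℝ), x₀ ∉ S' := by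
    obtain ⟨x, hx, hxS⟩ := (Iio_infinite (0 : ℝ)).exists_notMem_finset S'
    exact ⟨x, hx, hxS⟩
  have hzero : ∀ x, x ∉ S' → Φ x = 0 := fun x hx => by
    rw [eq_of_locally_const S' hconst hlim' hx hx₀S, hleft x₀ hx₀]
  constructor
  · obtain ⟨x, hx, hxS⟩ := (Ioi_infinite (1 : ℝ)).exists_notMem_finset S'
    have := hright x hx
    rw [hzero x hxS] at this
    exact (sub_eq_zero.1 this.symm).symm
  · intro x
    have := integral_eq_of_hasDerivAt_off_countable_of_le (ext W)
      (fun x => ext (primitive F) x - fluxStep η c x) x.2.1 S'.countable_toSet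
      (continuous_ext W).continuousOn (fun y hy => by
        have hy' := (hS'mem y).1 hy.2
        have h₁ := hd y ⟨hy.1.1, hy.1.2.trans_le x.2.2⟩ hy'.1.1
        rwa [sub_eq_zero.1 (hzero y hy.2)] at h₁)
      (intervalIntegrable_slope F (left_mem_Icc.2 zero_le_one) x.2)
    rw [primitive_slope, this, ext_coe, ext_of_mem W (left_mem_Icc.2 zero_le_one)]
    change _ = W 0 + (W x - W 0)
    ring

lemma isProfile_iff_isSolution (hη : ∀ i, η i ∈ Icc (0 : ℝ) 1) {F : State} {W : Prof} :
    IsProfile (pointFlux η c) (ext W) F ↔ IsSolution η c F W :=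
  ⟨fun h => h.isSolution hη, fun h => h.isProfile hη⟩

/-- The energy identity `∫ Z'' Z̄ = -∫ |Z'|² + ∑ i, c i Z̄(η i)`. -/
lemma IsSolution.inner_eq (hη : ∀ i, η i ∈ Icc (0 : ℝ) 1) {F : State} {Z : Prof}
    (h : IsSolution η c F Z) : inner ℂ (toState Z) F =
      -((‖slope η c F‖ ^ 2 : ℝ) : ℂ) + ∑ i, c i * starRingEnd ℂ (ext Z (η i)) := by
  set D := slope η c F with hD
  have hone : ∀ x : unitInterval, (box 0 1 : State) = box 0 x + box x 1 := fun x => by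
    rw [← box_sub_box x.2.1 x.2.2]; abel
  have hZ : toState Z = Z 0 • box 0 1 + toState (primitive D) := by
    apply Lp.ext
    filter_upwards [coeFn_toState Z, coeFn_toState (primitive D),
      Lp.coeFn_add (Z 0 • box 0 1) (toState (primitive D)), Lp.coeFn_smul (Z 0) (box 0 1),
      coeFn_box 0 1, ae_restrict_of_ae (Measure.ae_ne volume (0 : ℝ)),
      ae_restrict_mem measurableSet_Icc] with x h₁ h₂ h₃ h₄ h₅ h₆ h₇
    rw [h₁, h₃, Pi.add_apply, h₄, Pi.smul_apply, h₅, h₂, ext_of_mem _ h₇, ext_of_mem _ h₇, h.2,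
      indicator_of_mem (mem_Ioc.2 ⟨lt_of_le_of_ne h₇.1 (Ne.symm h₆), h₇.2⟩), smul_eq_mul, mul_one]
  have h₁ : inner ℂ (box 0 1) F = ∑ i, c i := by
    rw [← h.1]; rfl
  have h₂ : toState (primitive F) = D + ∑ i, c i • box (η i) 1 := by
    rw [hD, slope]; abel
  have h₃ : ∀ i, inner ℂ D (box (η i) 1) = starRingEnd ℂ (Z 1 - ext Z (η i)) := by
    intro i
    have := inner_box_eq_sub D (a := ⟨η i, hη i⟩) (b := 1) unitInterval.le_one'
    rw [← inner_conj_symm]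
    congr 1
    rw [ext_of_mem _ (hη i), h.2, h.2 ⟨η i, hη i⟩]
    refine this.trans ?_
    ring
  have h₄ := inner_primitive_add D F
  have h₅ : primitive D 1 = Z 1 - Z 0 := by rw [h.2 1]; ring
  have h₆ : inner ℂ D (toState (primitive F)) =
      ((‖D‖ ^ 2 : ℝ) : ℂ) + ∑ i, c i * starRingEnd ℂ (Z 1 - ext Z (η i)) := by
    rw [h₂, inner_add_right, inner_self_eq_norm_sq_to_K, inner_sum]
    simp only [inner_smul_right, h₃]
    simp
  rw [h₅, h₆, h.1] at h₄
  rw [hZ, inner_add_left, inner_smul_left, h₁]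
  have h₇ : ∑ i, c i * starRingEnd ℂ (Z 1 - ext Z (η i)) =
      starRingEnd ℂ (Z 1) * ∑ i, c i - ∑ i, c i * starRingEnd ℂ (ext Z (η i)) := by
    rw [Finset.mul_sum, ← Finset.sum_sub_distrib]
    refine Finset.sum_congr rfl fun i _ => ?_
    rw [map_sub]; ring
  rw [h₇] at h₄
  rw [map_sub] at h₄
  linear_combination h₄

end Integrated

/-! ### Solution operators and the Fredholm alternative -/

section Fredholm

variable {n : ℕ} {η : Fin n → ℝ}

/-- `slope η c F` as a continuous linear function of `(F, c)`. -/
def slopeCLM (η : Fin n → ℝ) : State × (Fin n → ℂ) →L[ℂ] State :=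
  (toState ∘L primitive) ∘L ContinuousLinearMap.fst ℂ State (Fin n → ℂ) -
    ∑ i, ((ContinuousLinearMap.proj i : (Fin n → ℂ) →L[ℂ] ℂ) ∘L
      ContinuousLinearMap.snd ℂ State (Fin n → ℂ)).smulRight (box (η i) 1)

lemma slopeCLM_apply (F : State) (c : Fin n → ℂ) : slopeCLM η (F, c) = slope η c F := by
  simp [slopeCLM, slope]

/-- The defect of the flux balance plus the primitive of the slope.  At `x = 0` it reduces to the
defect, so that the two conditions in `IsSolution` become the single equation
`Z = Z 0 + liftCLM η (F, c)`. -/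
def liftCLM (η : Fin n → ℝ) : State × (Fin n → ℂ) →L[ℂ] Prof :=
  (ContinuousMap.evalCLM ℂ (1 : unitInterval) ∘L primitive ∘L
      ContinuousLinearMap.fst ℂ State (Fin n → ℂ) -
    ∑ i, (ContinuousLinearMap.proj i : (Fin n → ℂ) →L[ℂ] ℂ) ∘L
      ContinuousLinearMap.snd ℂ State (Fin n → ℂ)).smulRight (1 : Prof) + primitive ∘L slopeCLM η

lemma liftCLM_apply (F : State) (c : Fin n → ℂ) (x : unitInterval) :
    liftCLM η (F, c) x = (primitive F 1 - ∑ i, c i) + primitive (slope η c F) x := by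
  rw [← slopeCLM_apply]
  simp [liftCLM]

lemma isSolution_iff {c : Fin n → ℂ} {F : State} {Z : Prof} :
    IsSolution η c F Z ↔ Z = Z 0 • (1 : Prof) + liftCLM η (F, c) := by
  constructor
  · rintro ⟨h₁, h₂⟩
    ext x
    rw [h₂ x]
    simp [liftCLM_apply, h₁]
  · intro h
    have h' : ∀ x, Z x = Z 0 + ((primitive F 1 - ∑ i, c i) + primitive (slope η c F) x) := by
      intro x
      have := congrArg (fun W : Prof => W x) h
      simpa [liftCLM_apply] using this
    have h₀ : primitive F 1 - ∑ i, c i = 0 := by simpa using h' 0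
    refine ⟨sub_eq_zero.1 h₀, fun x => ?_⟩
    rw [h' x, h₀, zero_add]

lemma isCompactOperator_smulRight {E F : Type*} [NormedAddCommGroup E] [NormedSpace ℂ E]
    [NormedAddCommGroup F] [NormedSpace ℂ F] (l : E →L[ℂ] ℂ) (v : F) :
    IsCompactOperator (l.smulRight v) :=
  ((isCompactOperator_id (E := ℂ)).comp_clm l).clm_comp (ContinuousLinearMap.toSpanSingleton ℂ v)

lemma isCompactOperator_liftCLM : IsCompactOperator (liftCLM η) :=
  (isCompactOperator_smulRight _ _).add (isCompactOperator_primitive.comp_clm (slopeCLM η))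

/-- The Fredholm alternative for a rod whose fluxes `φ Z` and uniform source `s Z` depend linearly on
its profile: at each `μ` there is an eigenfunction, or the resolvent problem with right-hand side `g`
and additional fluxes `d` is solved by a compact operator. -/
theorem eigenfunction_or_solution_operator (η : Fin n → ℝ) (φ : Prof →L[ℂ] (Fin n → ℂ))
    (s : Prof →L[ℂ] ℂ) (μ : ℂ) :
    (∃ Z ≠ 0, IsSolution η (φ Z) (μ • toState Z + s Z • toState 1) Z) ∨
    ∃ S : State × (Fin n → ℂ) →L[ℂ] Prof, IsCompactOperator S ∧ ∀ Z g d,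
      IsSolution η (φ Z + d) (μ • toState Z + s Z • toState 1 - g) Z ↔ Z = S (g, d) := by
  set T : Prof →L[ℂ] Prof := (ContinuousMap.evalCLM ℂ (0 : unitInterval)).smulRight (1 : Prof) +
    liftCLM η ∘L ((μ • toState + s.smulRight (toState 1)).prod φ) with hT
  have hTapp : ∀ Z, T Z = Z 0 • (1 : Prof) +
      liftCLM η (μ • toState Z + s Z • toState 1, φ Z) := fun Z => by
    simp [hT]
  have hTc : IsCompactOperator T :=
    (isCompactOperator_smulRight _ _).add (isCompactOperator_liftCLM.comp_clm _)
  have heq : ∀ Z g d, IsSolution η (φ Z + d) (μ • toState Z + s Z • toState 1 - g) Z ↔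
      (1 - T) Z = liftCLM η (-g, d) := by
    intro Z g d
    have h₁ : ((μ • toState Z + s Z • toState 1 - g, φ Z + d) : State × (Fin n → ℂ)) =
        (μ • toState Z + s Z • toState 1, φ Z) + (-g, d) := by
      rw [Prod.mk_add_mk, sub_eq_add_neg]
    rw [isSolution_iff, h₁, map_add, ← add_assoc, ← hTapp, sub_apply, one_apply_eq_self,
      sub_eq_iff_eq_add, add_comm]
  rcases hTc.hasEigenvalue_or_mem_resolventSet one_ne_zero with h | h
  · left
    obtain ⟨Z, hZ⟩ := h.exists_hasEigenvector
    refine ⟨Z, hZ.2, ?_⟩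
    have h₁ : T Z = Z := by simpa using hZ.apply_eq_smul
    have h₂ := (heq Z 0 0).2 (by
      rw [neg_zero, Prod.mk_zero_zero, map_zero, sub_apply, one_apply_eq_self, h₁, sub_self])
    simpa using h₂
  · right
    rw [spectrum.mem_resolventSet_iff, map_one] at h
    obtain ⟨U, hU⟩ := h
    refine ⟨(U⁻¹ : (Prof →L[ℂ] Prof)ˣ).val ∘L liftCLM η ∘L
      ((-ContinuousLinearMap.fst ℂ State (Fin n → ℂ)).prod (ContinuousLinearMap.snd ℂ _ _)),
      (isCompactOperator_liftCLM.comp_clm _).clm_comp _, fun Z g d => ?_⟩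
    rw [heq, ← hU]
    have hl : ∀ W, (U⁻¹ : (Prof →L[ℂ] Prof)ˣ).val (U.val W) = W := fun W =>
      congrArg (fun L : Prof →L[ℂ] Prof => L W) U.inv_mul
    have hr : ∀ W, U.val ((U⁻¹ : (Prof →L[ℂ] Prof)ˣ).val W) = W := fun W =>
      congrArg (fun L : Prof →L[ℂ] Prof => L W) U.mul_inv
    constructor
    · intro h
      change Z = (U⁻¹ : (Prof →L[ℂ] Prof)ˣ).val (liftCLM η (-g, d))
      rw [← h, hl]
    · rintro rfl
      exact hr _

/-- The graph of a rod is single-valued: a zero profile without fluxes has a zero source. -/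
lemma IsSolution.eq_zero {F : State} (h : IsSolution η 0 F 0) : F = 0 := by
  have h₁ : primitive (slope η 0 F) = 0 := by
    ext x
    simpa using (h.2 x).symm
  have h₂ : slope η 0 F = 0 := primitive_injective (by rw [h₁, map_zero])
  have h₃ : toState (primitive F) = 0 := by simpa [slope] using h₂
  have h₄ : primitive F = 0 := toState_injective (by rw [h₃, map_zero])
  exact primitive_injective (by rw [h₄, map_zero])

end Fredholm

/-! ### The graphs in integrated form -/

lemma IsProfile.congr {J J' Z Z' F F' : ℝ → ℂ} (h : IsProfile J Z F)
    (hJ : EqOn J J' (Icc 0 1)) (hZ : EqOn Z Z' (Icc 0 1))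
    (hF : F =ᵐ[volume.restrict (Icc (0 : ℝ) 1)] F') : IsProfile J' Z' F' := by
  obtain ⟨hc, S, dZ, hd, hint, hout, hlim⟩ := h
  refine ⟨hc.congr hZ.symm, S, dZ, fun x hx hxS => ?_, fun a b hab hsub => ?_, hout,
    fun x hx => ?_⟩
  · refine (hd x hx hxS).congr_of_eventuallyEq ?_
    filter_upwards [Ioo_mem_nhds hx.1 hx.2] with y hy using (hZ (Ioo_subset_Icc_self hy)).symm
  · rw [hint a b hab hsub]
    refine intervalIntegral.integral_congr_ae ?_
    filter_upwards [(ae_restrict_iff' measurableSet_Icc).1 hF] with x hx hx'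
    rw [uIoc_of_le hab.le] at hx'
    exact hx (Ioo_subset_Icc_self (hsub (Ioc_subset_Icc_self hx')).1)
  · rw [← hJ hx]
    exact hlim x hx

lemma IsProfile.sub {J J' Z Z' F F' : ℝ → ℂ} (h : IsProfile J Z F) (h' : IsProfile J' Z' F')
    (hF : IntegrableOn F (Icc 0 1)) (hF' : IntegrableOn F' (Icc 0 1)) :
    IsProfile (J - J') (Z - Z') (F - F') := by
  obtain ⟨hc, S, dZ, hd, hint, hout, hlim⟩ := h
  obtain ⟨hc', S', dZ', hd', hint', hout', hlim'⟩ := h'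
  refine ⟨hc.sub hc', S ∪ S', dZ - dZ', fun x hx hxS => ?_, fun a b hab hsub => ?_,
    fun x hx => ?_, fun x hx => ?_⟩
  · rw [Finset.mem_union, not_or] at hxS
    exact (hd x hx hxS.1).sub (hd' x hx hxS.2)
  · have hsub₁ : Icc a b ⊆ Ioo 0 1 \ (S : Set ℝ) := fun x hx =>
      ⟨(hsub hx).1, fun h => (hsub hx).2 (by simp [Finset.mem_coe.1 h])⟩
    have hsub₂ : Icc a b ⊆ Ioo 0 1 \ (S' : Set ℝ) := fun x hx =>
      ⟨(hsub hx).1, fun h => (hsub hx).2 (by simp [Finset.mem_coe.1 h])⟩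
    have hsub₃ : uIcc a b ⊆ Icc 0 1 := by
      rw [uIcc_of_le hab.le]
      exact fun x hx => Ioo_subset_Icc_self (hsub hx).1
    have h₁ := hint a b hab hsub₁
    have h₂ := hint' a b hab hsub₂
    simp only [Pi.sub_apply]
    rw [intervalIntegral.integral_sub (hF.mono_set hsub₃).intervalIntegrable
      (hF'.mono_set hsub₃).intervalIntegrable, ← h₁, ← h₂]
    ring
  · simp [hout x hx, hout' x hx]
  · obtain ⟨l, r, hl, hr, hlr⟩ := hlim x hx
    obtain ⟨l', r', hl', hr', hlr'⟩ := hlim' x hx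
    refine ⟨_, _, hl.sub hl', hr.sub hr', ?_⟩
    rw [Pi.sub_apply, ← hlr, ← hlr']
    ring

lemma mem_rod_iff {n : ℕ} {ξ β : Fin n → ℝ} (hξ : ∀ k, ξ k ∈ Icc (0 : ℝ) 1) {u : Fin n → ℂ}
    {z f : State} :
    (z, f) ∈ rod ξ β u ↔ ∃ Z : Prof, toState Z = z ∧ IsSolution ξ (fun k => β k * u k) f Z := by
  constructor
  · rintro ⟨Z, hZ, hP⟩
    obtain ⟨W, hW, rfl⟩ := hZ.exists_prof
    exact ⟨W, rfl, (hP.congr (fun _ _ => rfl) hW ae_eq_rfl).isSolution hξ⟩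
  · rintro ⟨Z, rfl, hZ⟩
    exact ⟨ext Z, represents_ext Z, hZ.isProfile hξ⟩

lemma mem_errorDynamics_iff {p : ℕ} {ζ a b : Fin p → ℝ} (hζ : ∀ i, ζ i ∈ Icc (0 : ℝ) 1)
    {e g : State} : (e, g) ∈ errorDynamics ζ a b ↔ ∃ E : Prof, toState E = e ∧
      IsSolution ζ (fun i => -((b i : ℂ) * ext E (ζ i)))
        (g + (∑ i, (a i : ℂ) * ext E (ζ i)) • toState 1) E := by
  have hae : ∀ (k : ℂ), (g + k • toState 1 : State)
      =ᵐ[volume.restrict (Icc (0 : ℝ) 1)] fun x => g x + k := by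
    intro k
    filter_upwards [Lp.coeFn_add g (k • toState 1), Lp.coeFn_smul k (toState 1),
      coeFn_toState 1, ae_restrict_mem measurableSet_Icc] with x h₁ h₂ h₃ h₄
    rw [h₁, Pi.add_apply, h₂, Pi.smul_apply, h₃, ext_of_mem _ h₄]
    simp
  constructor
  · rintro ⟨E, hE, hP⟩
    obtain ⟨W, hW, rfl⟩ := hE.exists_prof
    have hW' : ∀ i, E (ζ i) = ext W (ζ i) := fun i => hW (hζ i)
    simp only [hW'] at hP
    exact ⟨W, rfl, (hP.congr (fun _ _ => rfl) hW (hae _).symm).isSolution hζ⟩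
  · rintro ⟨E, rfl, hE⟩
    exact ⟨ext E, represents_ext E, (hE.isProfile hζ).congr (fun _ _ => rfl) (fun _ _ => rfl)
      (hae _)⟩

lemma integrableOn_state_add_const (f : State) (k : ℂ) :
    IntegrableOn (fun x => f x + k) (Icc (0 : ℝ) 1) :=
  (integrableOn_state f).add (integrable_const k)

lemma pointFlux_neg {n : ℕ} (η : Fin n → ℝ) (g : Fin n → ℂ) (x : ℝ) :
    pointFlux η (fun i => -g i) x = -pointFlux η g x := by
  simp only [pointFlux, ← Finset.sum_neg_distrib]
  exact Finset.sum_congr rfl fun i _ => by split_ifs <;> simp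

/-- The block triangular form: subtract the filter from the rod. -/
lemma mem_lqgSystemErr_iff {n p : ℕ} {ξ β : Fin n → ℝ} {K : Fin n → ℝ → ℝ} {ζ a b : Fin p → ℝ}
    (z e f g : State) :
    ((z, e), (f, g)) ∈ lqgSystemErr ξ β K ζ a b ↔
      (e, g) ∈ errorDynamics ζ a b ∧ (z, f) ∈ rod ξ β (feedback K (z - e)) := by
  constructor
  · rintro ⟨Z, Y, hZ, hY, hPZ, hPY⟩
    refine ⟨⟨Z - Y, ⟨hZ.1.sub hY.1, ?_⟩, ?_⟩, Z, hZ, hPZ⟩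
    · filter_upwards [hZ.2, hY.2, Lp.coeFn_sub z e] with x h₁ h₂ h₃
      rw [h₃, Pi.sub_apply] at h₂
      rw [Pi.sub_apply, ← h₁, ← h₂]
      ring
    · have hI : IntegrableOn (fun x => (f - g : State) x - ∑ i, (a i : ℂ) * (Z (ζ i) - Y (ζ i)))
          (Icc 0 1) := by
        simpa only [sub_eq_add_neg] using integrableOn_state_add_const (f - g) _
      refine (hPZ.sub hPY (integrableOn_state f) hI).congr (fun x _ => ?_) (fun _ _ => rfl) ?_
      · rw [Pi.sub_apply, pointFlux_neg]
        simp only [Pi.sub_apply]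
        ring
      · filter_upwards [Lp.coeFn_sub f g] with x hx
        simp only [Pi.sub_apply, hx]
        ring
  · rintro ⟨⟨E, hE, hPE⟩, Z, hZ, hPZ⟩
    refine ⟨Z, Z - E, hZ, ⟨hZ.1.sub hE.1, ?_⟩, hPZ, ?_⟩
    · filter_upwards [hZ.2, hE.2, Lp.coeFn_sub z e] with x h₁ h₂ h₃
      rw [h₃, Pi.sub_apply, Pi.sub_apply, h₁, h₂]
    · refine (hPZ.sub hPE (integrableOn_state f) (integrableOn_state_add_const g _)).congr
        (fun x _ => ?_) (fun _ _ => rfl) ?_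
      · rw [Pi.sub_apply, pointFlux_neg]
        simp only [Pi.sub_apply, sub_sub_cancel]
        ring
      · filter_upwards [Lp.coeFn_sub f g] with x hx
        simp only [Pi.sub_apply, hx, sub_sub_cancel]
        ring

lemma zero_mem_errorDynamics {p : ℕ} {ζ a b : Fin p → ℝ} (hζ : ∀ i, ζ i ∈ Icc (0 : ℝ) 1) :
    ((0, 0) : State × State) ∈ errorDynamics ζ a b := by
  rw [mem_errorDynamics_iff hζ]
  have h0 : ∀ x : ℝ, ext 0 x = 0 := fun x => rfl
  refine ⟨0, map_zero _, by simp [h0], fun x => ?_⟩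
  simp [h0, slope]

/-! ### The spectrum of the combined system -/

lemma mem_spec_of_eigenvector {E : Type*} [NormedAddCommGroup E] [NormedSpace ℂ E]
    {G : Set (E × E)} {μ : ℂ} {w : E} (hw : w ≠ 0) (h : (w, μ • w) ∈ G) : μ ∈ spec G := by
  rintro ⟨R, hR⟩
  refine hw ?_
  have := (hR w 0).1 (by rwa [sub_zero])
  rwa [map_zero] at this

lemma toState_ne_zero {Z : Prof} (hZ : Z ≠ 0) : toState Z ≠ 0 := fun h =>
  hZ (toState_injective (by rw [h, map_zero]))

/-- The feedback functionals as a continuous linear map. -/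
lemma exists_feedbackCLM {n : ℕ} {K : Fin n → ℝ → ℝ} (hK : ∀ k, ContinuousOn (K k) (Icc 0 1)) :
    ∃ L : State →L[ℂ] (Fin n → ℂ), ∀ z, L z = feedback K z := by
  have hK' : ∀ k, ContinuousOn (fun x => (K k x : ℂ)) (Icc 0 1) := fun k =>
    Complex.continuous_ofReal.comp_continuousOn (hK k)
  set W : Fin n → Prof := fun k => ⟨(Icc (0 : ℝ) 1).domRestrict fun x => (K k x : ℂ),
    (hK' k).domRestrict⟩ with hW
  refine ⟨ContinuousLinearMap.pi fun k => innerSL ℂ (toState (W k)), fun z => ?_⟩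
  ext k
  change inner ℂ (toState (W k)) z = _
  rw [L2.inner_def, feedback]
  refine integral_congr_ae ?_
  filter_upwards [coeFn_toState (W k), ae_restrict_mem measurableSet_Icc] with x h₁ h₂
  rw [h₁, ext_of_mem _ h₂, RCLike.inner_apply, mul_comm]
  congr 1
  exact Complex.conj_ofReal _

section Spectrum

variable {n p : ℕ} {ξ β : Fin n → ℝ} {K : Fin n → ℝ → ℝ} {ζ a b : Fin p → ℝ}

lemma closedLoop_alternative (hξ : ∀ k, ξ k ∈ Icc (0 : ℝ) 1)
    (hK : ∀ k, ContinuousOn (K k) (Icc 0 1)) (μ : ℂ) :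
    (∃ z ≠ 0, (z, μ • z) ∈ closedLoop ξ β K) ∨
    ∃ S : State × (Fin n → ℂ) →L[ℂ] State, IsCompactOperator S ∧ ∀ z g u,
      (z, μ • z - g) ∈ rod ξ β (feedback K z + u) ↔ z = S (g, u) := by
  obtain ⟨L, hL⟩ := exists_feedbackCLM hK
  set B : (Fin n → ℂ) →L[ℂ] (Fin n → ℂ) :=
    ContinuousLinearMap.pi fun k => (β k : ℂ) • ContinuousLinearMap.proj k with hB
  have hBapp : ∀ u, B u = fun k => (β k : ℂ) * u k := fun u => by
    ext k; simp [hB]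
  rcases eigenfunction_or_solution_operator ξ (B ∘L L ∘L toState) 0 μ with ⟨Z, hZ, h⟩ | ⟨S, hS, h⟩
  · refine Or.inl ⟨toState Z, toState_ne_zero hZ, ?_⟩
    change (_, _) ∈ rod ξ β _
    rw [mem_rod_iff hξ]
    refine ⟨Z, rfl, ?_⟩
    simpa [hBapp, hL] using h
  · set P := (ContinuousLinearMap.fst ℂ State (Fin n → ℂ)).prod
      (B ∘L ContinuousLinearMap.snd ℂ State (Fin n → ℂ)) with hP
    refine Or.inr ⟨toState ∘L S ∘L P, (hS.comp_clm P).clm_comp toState, fun z g u => ?_⟩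
    rw [mem_rod_iff hξ]
    have h' : ∀ Z, IsSolution ξ (fun k => (β k : ℂ) * (feedback K (toState Z) + u) k)
        (μ • toState Z - g) Z ↔ Z = S (g, B u) := by
      intro Z
      rw [← h]
      simp only [ContinuousLinearMap.comp_apply, hL, zero_apply, zero_smul, add_zero]
      rw [← map_add, hBapp]
    constructor
    · rintro ⟨Z, rfl, hZ⟩
      exact congrArg toState ((h' Z).1 hZ)
    · rintro rfl
      exact ⟨S (g, B u), rfl, (h' _).2 rfl⟩

lemma errorDynamics_alternative (hζ : ∀ i, ζ i ∈ Icc (0 : ℝ) 1) (μ : ℂ) :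
    (∃ e ≠ 0, (e, μ • e) ∈ errorDynamics ζ a b) ∨
    ∃ S : State →L[ℂ] State, IsCompactOperator S ∧ IsResolvent (errorDynamics ζ a b) μ S := by
  set φ : Prof →L[ℂ] (Fin p → ℂ) :=
    ContinuousLinearMap.pi fun i => -((b i : ℂ) • ContinuousMap.evalCLM ℂ ⟨ζ i, hζ i⟩) with hφ
  set s : Prof →L[ℂ] ℂ := ∑ i, (a i : ℂ) • ContinuousMap.evalCLM ℂ ⟨ζ i, hζ i⟩ with hs
  have hφapp : ∀ E, φ E = fun i => -((b i : ℂ) * ext E (ζ i)) := fun E => by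
    ext i
    simp [hφ, ext_of_mem _ (hζ i)]
  have hsapp : ∀ E, s E = ∑ i, (a i : ℂ) * ext E (ζ i) := fun E => by
    simp [hs, ext_of_mem _ (hζ _)]
  rcases eigenfunction_or_solution_operator ζ φ s μ with ⟨E, hE, h⟩ | ⟨S, hS, h⟩
  · refine Or.inl ⟨toState E, toState_ne_zero hE, ?_⟩
    rw [mem_errorDynamics_iff hζ]
    refine ⟨E, rfl, ?_⟩
    rwa [← hφapp, ← hsapp]
  · refine Or.inr ⟨toState ∘L S ∘L ContinuousLinearMap.inl ℂ State (Fin p → ℂ),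
      (hS.comp_clm (ContinuousLinearMap.inl ℂ State (Fin p → ℂ))).clm_comp toState,
      fun e g => ?_⟩
    rw [mem_errorDynamics_iff hζ]
    have h' : ∀ E, IsSolution ζ (fun i => -((b i : ℂ) * ext E (ζ i)))
        (μ • toState E - g + (∑ i, (a i : ℂ) * ext E (ζ i)) • toState 1) E ↔ E = S (g, 0) := by
      intro E
      rw [← h, ← hφapp, ← hsapp, add_zero, sub_add_eq_add_sub]
    constructor
    · rintro ⟨E, rfl, hE⟩
      exact congrArg toState ((h' E).1 hE)
    · rintro rfl
      exact ⟨S (g, 0), rfl, (h' _).2 rfl⟩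

/-- For the combined system in the coordinates `(z, e)`, every complex number is an eigenvalue or has a
compact resolvent; the first case occurs exactly on the union of the two spectra.  The triangular
form gives the resolvent by back substitution.  An eigenvector of the error dynamics extends to one
of the combined system unless the eigenvalue already belongs to the closed loop. -/
theorem lqgSystemErr_alternative (hξ : ∀ k, ξ k ∈ Icc (0 : ℝ) 1)
    (hK : ∀ k, ContinuousOn (K k) (Icc 0 1)) (hζ : ∀ i, ζ i ∈ Icc (0 : ℝ) 1) (μ : ℂ) :
    ((∃ w ≠ 0, (w, μ • w) ∈ lqgSystemErr ξ β K ζ a b) ∧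
      μ ∈ spec (closedLoop ξ β K) ∪ spec (errorDynamics ζ a b)) ∨
    (∃ R : State × State →L[ℂ] State × State,
      IsCompactOperator R ∧ IsResolvent (lqgSystemErr ξ β K ζ a b) μ R) ∧
      μ ∉ spec (closedLoop ξ β K) ∪ spec (errorDynamics ζ a b) := by
  obtain ⟨L, hL⟩ := exists_feedbackCLM hK
  have hsub : ∀ z e, feedback K (z - e) = feedback K z + -L e := fun z e => by
    rw [← hL, map_sub, hL, hL, sub_eq_add_neg]
  rcases closedLoop_alternative (β := β) hξ hK μ with ⟨z, hz, h⟩ | ⟨S, hS, h⟩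
  · refine Or.inl ⟨⟨(z, 0), fun h0 => hz (congrArg Prod.fst h0), ?_⟩,
      Or.inl (mem_spec_of_eigenvector hz h)⟩
    rw [Prod.smul_mk, smul_zero, mem_lqgSystemErr_iff, sub_zero]
    exact ⟨zero_mem_errorDynamics hζ, h⟩
  have hcl : μ ∉ spec (closedLoop ξ β K) := by
    rw [notMem_spec_iff]
    refine ⟨S ∘L ContinuousLinearMap.inl ℂ State (Fin n → ℂ), fun z g => ?_⟩
    have := h z g 0
    rw [add_zero] at this
    exact this
  rcases errorDynamics_alternative (a := a) (b := b) hζ μ with ⟨e, he, h'⟩ | ⟨S', hS', h'⟩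
  · refine Or.inl ⟨⟨(S (0, -L e), e), fun h0 => he (congrArg Prod.snd h0), ?_⟩,
      Or.inr (mem_spec_of_eigenvector he h')⟩
    rw [Prod.smul_mk, mem_lqgSystemErr_iff, hsub]
    refine ⟨h', ?_⟩
    have := (h (S (0, -L e)) 0 (-L e)).2 rfl
    rwa [sub_zero] at this
  · refine Or.inr ⟨⟨(S ∘L ((ContinuousLinearMap.fst ℂ State State).prod
      (-(L ∘L S' ∘L ContinuousLinearMap.snd ℂ State State)))).prod
      (S' ∘L ContinuousLinearMap.snd ℂ State State), ?_, ?_⟩, ?_⟩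
    · have h₁ := (hS.comp_clm ((ContinuousLinearMap.fst ℂ State State).prod
        (-(L ∘L S' ∘L ContinuousLinearMap.snd ℂ State State)))).clm_comp
        (ContinuousLinearMap.inl ℂ State State)
      have h₂ := (hS'.comp_clm (ContinuousLinearMap.snd ℂ State State)).clm_comp
        (ContinuousLinearMap.inr ℂ State State)
      refine Eq.subst (motive := IsCompactOperator) ?_ (h₁.add h₂)
      funext w
      apply Prod.ext <;> simp
    · rintro ⟨z, e⟩ ⟨g₁, g₂⟩
      rw [Prod.smul_mk, Prod.mk_sub_mk, mem_lqgSystemErr_iff, hsub, h, h' e g₂]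
      constructor
      · rintro ⟨rfl, rfl⟩
        rfl
      · intro h0
        have h₁ : z = S (g₁, -L (S' g₂)) := congrArg Prod.fst h0
        have h₂ : e = S' g₂ := congrArg Prod.snd h0
        exact ⟨h₂, by rw [h₁, h₂]⟩
    · rintro (h₁ | h₁)
      · exact hcl h₁
      · exact notMem_spec_iff.2 ⟨S', h'⟩ h₁

lemma spec_lqgSystemErr (hξ : ∀ k, ξ k ∈ Icc (0 : ℝ) 1)
    (hK : ∀ k, ContinuousOn (K k) (Icc 0 1)) (hζ : ∀ i, ζ i ∈ Icc (0 : ℝ) 1) :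
    spec (lqgSystemErr ξ β K ζ a b) = spec (closedLoop ξ β K) ∪ spec (errorDynamics ζ a b) := by
  ext μ
  rcases lqgSystemErr_alternative (β := β) (a := a) (b := b) hξ hK hζ μ with
    ⟨⟨w, hw, h⟩, h'⟩ | ⟨⟨R, -, hR⟩, h'⟩
  · exact ⟨fun _ => h', fun _ => mem_spec_of_eigenvector hw h⟩
  · exact ⟨fun h => absurd h (notMem_spec_iff.2 ⟨R, hR⟩), fun h => absurd h h'⟩

end Spectrum

/-! ### Change of coordinates -/

section Transfer

variable {E E' : Type*} [NormedAddCommGroup E] [NormedSpace ℂ E] [NormedAddCommGroup E']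
  [NormedSpace ℂ E'] (Φ : E ≃L[ℂ] E') {G : Set (E' × E')}

/-- The graph `G` in the coordinates given by `Φ`. -/
def pullback (G : Set (E' × E')) : Set (E × E) := {p | (Φ p.1, Φ p.2) ∈ G}

variable {Φ}

lemma mem_pullback {w v : E} : (w, v) ∈ pullback Φ G ↔ (Φ w, Φ v) ∈ G := Iff.rfl

lemma isResolvent_pullback_iff {μ : ℂ} {R : E' →L[ℂ] E'} : IsResolvent (pullback Φ G) μ
    ((Φ.symm : E' →L[ℂ] E) ∘L R ∘L (Φ : E →L[ℂ] E')) ↔ IsResolvent G μ R := by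
  constructor
  · intro h w g
    have := h (Φ.symm w) (Φ.symm g)
    rw [mem_pullback] at this
    simpa using this
  · intro h w g
    rw [mem_pullback, map_sub, map_smul, h]
    exact Φ.eq_symm_apply.symm

lemma spec_pullback : spec (pullback Φ G) = spec G := by
  ext μ
  rw [← not_iff_not, notMem_spec_iff, notMem_spec_iff]
  constructor
  · rintro ⟨R, hR⟩
    refine ⟨(Φ : E →L[ℂ] E') ∘L R ∘L (Φ.symm : E' →L[ℂ] E),
      (isResolvent_pullback_iff (Φ := Φ)).1 ?_⟩
    convert hR using 1
    ext x
    simp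
  · rintro ⟨R, hR⟩
    exact ⟨_, isResolvent_pullback_iff.2 hR⟩

lemma isTrajectory_pullback_iff {u : ℝ → E} :
    IsTrajectory (pullback Φ G) u ↔ IsTrajectory G fun t => Φ (u t) := by
  have hder : ∀ (v : E) (t : ℝ), HasDerivAt u v t → HasDerivAt (fun t => Φ (u t)) (Φ v) t :=
    fun v t h => (((Φ : E →L[ℂ] E').restrictScalars ℝ).hasFDerivAt).comp_hasDerivAt t h
  constructor
  · rintro ⟨hc, hd⟩
    refine ⟨Φ.continuous.comp_continuousOn hc, fun t ht => ?_⟩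
    obtain ⟨v, hv, hG⟩ := hd t ht
    exact ⟨Φ v, hder v t hv, hG⟩
  · rintro ⟨hc, hd⟩
    refine ⟨by simpa [Function.comp_def] using Φ.symm.continuous.comp_continuousOn hc,
      fun t ht => ?_⟩
    obtain ⟨v, hv, hG⟩ := hd t ht
    refine ⟨Φ.symm v, ?_, ?_⟩
    · have := (((Φ.symm : E' →L[ℂ] E).restrictScalars ℝ).hasFDerivAt).comp_hasDerivAt t hv
      simpa [Function.comp_def] using this
    · rw [mem_pullback, Φ.apply_symm_apply]
      exact hG

lemma IsTrajectory.symm_comp {u : ℝ → E'} (hu : IsTrajectory G u) :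
    IsTrajectory (pullback Φ G) fun t => Φ.symm (u t) :=
  isTrajectory_pullback_iff.2 (by simpa using hu)

lemma AsymptoticallyStable.of_pullback (h : AsymptoticallyStable (pullback Φ G)) :
    AsymptoticallyStable G := by
  obtain ⟨h₁, h₂, h₃⟩ := h
  refine ⟨fun w => ?_, fun ε hε => ?_, fun u hu => ?_⟩
  · obtain ⟨u, hu, hu0⟩ := h₁ (Φ.symm w)
    exact ⟨_, isTrajectory_pullback_iff.1 hu, by simp [hu0]⟩
  · have hpos : ∀ L : ℝ, 0 < |L| + 1 := fun L => by positivity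
    obtain ⟨δ, hδ, h⟩ := h₂ (ε / (|‖(Φ : E →L[ℂ] E')‖| + 1)) (by positivity)
    refine ⟨δ / (|‖(Φ.symm : E' →L[ℂ] E)‖| + 1), by positivity, fun u hu hu0 t ht => ?_⟩
    have h₄ : ‖Φ.symm (u 0)‖ < δ := by
      rw [lt_div_iff₀ (hpos _)] at hu0
      refine ((Φ.symm : E' →L[ℂ] E).le_opNorm (u 0)).trans_lt (lt_of_le_of_lt ?_ hu0)
      rw [mul_comm]
      gcongr
      linarith [le_abs_self ‖(Φ.symm : E' →L[ℂ] E)‖]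
    have h₅ := h _ hu.symm_comp h₄ t ht
    rw [lt_div_iff₀ (hpos _)] at h₅
    have h₆ := (Φ : E →L[ℂ] E').le_opNorm (Φ.symm (u t))
    rw [ContinuousLinearEquiv.coe_coe, Φ.apply_symm_apply] at h₆
    refine h₆.trans_lt (lt_of_le_of_lt ?_ h₅)
    rw [mul_comm]
    gcongr
    linarith [le_abs_self ‖(Φ : E →L[ℂ] E')‖]
  · have := (Φ.continuous.tendsto 0).comp (h₃ _ hu.symm_comp)
    simpa [Function.comp_def] using this

end Transfer

/-! ### Energy estimates for the combined system -/

section Energy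

variable {n p : ℕ} {ξ β : Fin n → ℝ} {K : Fin n → ℝ → ℝ} {ζ a b : Fin p → ℝ}

lemma norm_sum_mul_le {n : ℕ} {c d : Fin n → ℂ} {A M N : ℝ} (hA : ∀ i, ‖c i‖ ≤ A * M)
    (hd : ∀ i, ‖d i‖ ≤ N) (hM : 0 ≤ A * M) : ‖∑ i, c i * d i‖ ≤ n * A * (M * N) := by
  refine (norm_sum_le_of_le (f := fun i => c i * d i) (n := fun _ => A * M * N) Finset.univ
    fun i _ => ?_).trans_eq ?_
  · rw [norm_mul]
    exact mul_le_mul (hA i) (hd i) (norm_nonneg _) hM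
  · simp only [Finset.sum_const, Finset.card_univ, Fintype.card_fin, nsmul_eq_mul]
    ring

lemma norm_toState_le (Z : Prof) : ‖toState Z‖ ≤ ‖Z‖ := by
  have := toState.le_of_opNorm_le (LinearMap.mkContinuous_norm_le _ zero_le_one _) Z
  rwa [one_mul] at this

/-- The energy balance of the combined system: minus the Dirichlet integrals of `z` and `e`, up to a
term bounded by the squares of the supremum norms. -/
lemma exists_energy_balance (hξ : ∀ k, ξ k ∈ Icc (0 : ℝ) 1)
    (hK : ∀ k, ContinuousOn (K k) (Icc 0 1)) (hζ : ∀ i, ζ i ∈ Icc (0 : ℝ) 1) :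
    ∃ C : ℝ, 0 ≤ C ∧ ∀ z e f g : State, ((z, e), (f, g)) ∈ lqgSystemErr ξ β K ζ a b →
      ∃ (Z E : Prof) (D D' : State), toState Z = z ∧ toState E = e ∧
        (∀ x, Z x = Z 0 + primitive D x) ∧ (∀ x, E x = E 0 + primitive D' x) ∧
        ∃ q : ℂ, inner ℂ z f + inner ℂ e g = -((‖D‖ ^ 2 + ‖D'‖ ^ 2 : ℝ) : ℂ) + q ∧
          ‖q‖ ≤ C * (‖Z‖ + ‖E‖) ^ 2 := by
  obtain ⟨L, hL⟩ := exists_feedbackCLM hK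
  refine ⟨n * (∑ k, |β k| * ‖L‖) + p * (∑ i, |b i|) + ∑ i, |a i|, by positivity,
    fun z e f g h => ?_⟩
  rw [mem_lqgSystemErr_iff, mem_errorDynamics_iff hζ, mem_rod_iff hξ] at h
  obtain ⟨⟨E, rfl, hE⟩, Z, rfl, hZ⟩ := h
  refine ⟨Z, E, _, _, rfl, rfl, hZ.2, hE.2,
    ∑ k, ((β k : ℂ) * feedback K (toState Z - toState E) k) * starRingEnd ℂ (ext Z (ξ k)) +
      (∑ i, -((b i : ℂ) * ext E (ζ i)) * starRingEnd ℂ (ext E (ζ i)) -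
        (∑ i, (a i : ℂ) * ext E (ζ i)) * inner ℂ (toState E) (toState 1)), ?_, ?_⟩
  · have h₁ := hZ.inner_eq hξ
    have h₂ := hE.inner_eq hζ
    rw [inner_add_right, inner_smul_right] at h₂
    rw [Complex.ofReal_add]
    linear_combination h₁ + h₂
  · set M := ‖Z‖ + ‖E‖ with hM
    have hM0 : 0 ≤ M := by positivity
    have hZM : ‖Z‖ ≤ M := le_add_of_nonneg_right (norm_nonneg E)
    have hEM : ‖E‖ ≤ M := le_add_of_nonneg_left (norm_nonneg Z)
    have hconj : ∀ (W : Prof) (x : ℝ), ‖W‖ ≤ M → ‖starRingEnd ℂ (ext W x)‖ ≤ M := fun W x hW => by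
      rw [RCLike.norm_conj]
      exact (norm_ext_le W x).trans hW
    have h₁ : ‖∑ k, ((β k : ℂ) * feedback K (toState Z - toState E) k) *
        starRingEnd ℂ (ext Z (ξ k))‖ ≤ n * (∑ k, |β k| * ‖L‖) * (M * M) := by
      refine norm_sum_mul_le (fun k => ?_) (fun k => hconj Z (ξ k) hZM) (by positivity)
      have h₂ : ‖feedback K (toState Z - toState E) k‖ ≤ ‖L‖ * M := by
        rw [← hL]
        refine (norm_le_pi_norm _ k).trans ((L.le_opNorm _).trans ?_)
        gcongr
        exact (norm_sub_le _ _).trans (add_le_add (norm_toState_le Z) (norm_toState_le E))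
      calc ‖(β k : ℂ) * feedback K (toState Z - toState E) k‖ ≤ |β k| * (‖L‖ * M) := by
            rw [norm_mul, Complex.norm_real, Real.norm_eq_abs]
            gcongr
        _ = |β k| * ‖L‖ * M := by ring
        _ ≤ (∑ k, |β k| * ‖L‖) * M := by
            gcongr
            exact Finset.single_le_sum (f := fun k => |β k| * ‖L‖) (fun j _ => by positivity)
              (Finset.mem_univ k)
    have h₂ : ‖∑ i, -((b i : ℂ) * ext E (ζ i)) * starRingEnd ℂ (ext E (ζ i))‖ ≤
        p * (∑ i, |b i|) * (M * M) := by
      refine norm_sum_mul_le (fun i => ?_) (fun i => hconj E (ζ i) hEM) (by positivity)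
      rw [norm_neg, norm_mul, Complex.norm_real, Real.norm_eq_abs]
      refine mul_le_mul ?_ ((norm_ext_le E _).trans hEM) (norm_nonneg _) (by positivity)
      exact Finset.single_le_sum (f := fun i => |b i|) (fun j _ => abs_nonneg _) (Finset.mem_univ i)
    have h₃ : ‖(∑ i, (a i : ℂ) * ext E (ζ i)) * inner ℂ (toState E) (toState 1)‖ ≤
        (∑ i, |a i|) * (M * M) := by
      have h₄ : ‖∑ i, (a i : ℂ) * ext E (ζ i)‖ ≤ (∑ i, |a i|) * M := by
        rw [Finset.sum_mul]
        refine norm_sum_le_of_le _ fun i _ => ?_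
        rw [norm_mul, Complex.norm_real, Real.norm_eq_abs]
        gcongr
        exact (norm_ext_le E _).trans hEM
      have h₅ : ‖inner ℂ (toState E) (toState 1)‖ ≤ M := by
        refine (norm_inner_le_norm _ _).trans ?_
        have h₆ : ‖toState 1‖ ≤ 1 := (norm_toState_le 1).trans (by simp)
        calc _ ≤ M * 1 := by
              gcongr
              exact (norm_toState_le E).trans hEM
          _ = M := mul_one M
      rw [norm_mul, ← mul_assoc]
      exact mul_le_mul h₄ h₅ (norm_nonneg _) (by positivity)
    refine (norm_add_le _ _).trans ((add_le_add h₁ ((norm_sub_le _ _).trans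
      (add_le_add h₂ h₃))).trans_eq ?_)
    ring

/-- The Gårding inequality of the combined system, and the resulting bound of the supremum norms by
the graph norm. -/
lemma exists_garding (hξ : ∀ k, ξ k ∈ Icc (0 : ℝ) 1)
    (hK : ∀ k, ContinuousOn (K k) (Icc 0 1)) (hζ : ∀ i, ζ i ∈ Icc (0 : ℝ) 1) :
    ∃ ω : ℝ, 0 ≤ ω ∧ ∀ z e f g : State, ((z, e), (f, g)) ∈ lqgSystemErr ξ β K ζ a b →
      (inner ℂ z f + inner ℂ e g).re + |(inner ℂ z f + inner ℂ e g).im| ≤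
        ω * (‖z‖ ^ 2 + ‖e‖ ^ 2) ∧
      ∃ Z E : Prof, toState Z = z ∧ toState E = e ∧ (‖Z‖ + ‖E‖) ^ 2 ≤
        ω * (‖z‖ ^ 2 + ‖e‖ ^ 2) + 8 * (‖z‖ * ‖f‖ + ‖e‖ * ‖g‖) := by
  obtain ⟨C, hC, h⟩ := exists_energy_balance (β := β) (a := a) (b := b) hξ hK hζ
  -- `t` is chosen so that interpolation absorbs the perturbation in half of the Dirichlet integrals
  set t : ℝ := 1 / (4 * (C + 1)) with ht
  have ht0 : 0 < t := by positivity
  have ht1 : t ≤ 1 := by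
    rw [ht, div_le_one (by positivity)]
    linarith
  have hCt : C * (8 * t ^ 2) ≤ 1 / 2 := by
    rw [ht, div_pow, one_pow, mul_pow, ← mul_div_assoc, ← mul_div_assoc,
      div_le_div_iff₀ (by positivity) (by norm_num)]
    nlinarith
  refine ⟨16 * C * (4 / t ^ 2) + 4, by positivity, fun z e f g hG => ?_⟩
  obtain ⟨Z, E, D, D', rfl, rfl, hZ, hE, q, hq, hqle⟩ := h z e f g hG
  set N := ‖toState Z‖ ^ 2 + ‖toState E‖ ^ 2 with hN
  set Q := ‖D‖ ^ 2 + ‖D'‖ ^ 2 with hQ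
  have hN0 : 0 ≤ N := by positivity
  have hQ0 : 0 ≤ Q := by positivity
  have hsq : ∀ t : ℝ, 0 < t → t ≤ 1 → (‖Z‖ + ‖E‖) ^ 2 ≤ 4 / t ^ 2 * N + 4 * t ^ 2 * Q := by
    intro t ht0 ht1
    have h₁ := norm_prof_le hZ ht0 ht1
    have h₂ := norm_prof_le hE ht0 ht1
    calc (‖Z‖ + ‖E‖) ^ 2 ≤ ((‖toState Z‖ / t + t * ‖D‖) + (‖toState E‖ / t + t * ‖D'‖)) ^ 2 := by
          gcongr
      _ ≤ 4 * (‖toState Z‖ / t) ^ 2 + 4 * (t * ‖D‖) ^ 2 + 4 * (‖toState E‖ / t) ^ 2 +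
          4 * (t * ‖D'‖) ^ 2 := by
          generalize ‖toState Z‖ / t = x₁
          generalize t * ‖D‖ = x₂
          generalize ‖toState E‖ / t = x₃
          generalize t * ‖D'‖ = x₄
          nlinarith [sq_nonneg (x₁ - x₂), sq_nonneg (x₁ - x₃), sq_nonneg (x₁ - x₄),
            sq_nonneg (x₂ - x₃), sq_nonneg (x₂ - x₄), sq_nonneg (x₃ - x₄)]
      _ = 4 / t ^ 2 * N + 4 * t ^ 2 * Q := by
          rw [hN, hQ]; ring
  have hre : (inner ℂ (toState Z) f + inner ℂ (toState E) g).re = -Q + q.re := by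
    rw [hq, Complex.add_re, Complex.neg_re, Complex.ofReal_re]
  have him : (inner ℂ (toState Z) f + inner ℂ (toState E) g).im = q.im := by
    rw [hq, Complex.add_im, Complex.neg_im, Complex.ofReal_im, neg_zero, zero_add]
  have hq₁ : q.re ≤ ‖q‖ := Complex.re_le_norm q
  have hq₂ : |q.im| ≤ ‖q‖ := Complex.abs_im_le_norm q
  -- the perturbation is at most a quarter of the Dirichlet integrals plus a multiple of `N`
  have hpert : ‖q‖ ≤ C * (4 / t ^ 2) * N + Q / 4 := by
    have h₁ := mul_le_mul_of_nonneg_left (hsq t ht0 ht1) hC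
    have h₂ := mul_le_mul_of_nonneg_right hCt hQ0
    nlinarith
  have hCN : 0 ≤ C * (4 / t ^ 2) * N := by positivity
  refine ⟨?_, Z, E, rfl, rfl, ?_⟩
  · rw [hre, him]
    nlinarith
  · have h₁ := hsq 1 one_pos le_rfl
    have h₂ : -(inner ℂ (toState Z) f + inner ℂ (toState E) g).re ≤
        ‖toState Z‖ * ‖f‖ + ‖toState E‖ * ‖g‖ := by
      refine (neg_le_abs _).trans ((Complex.abs_re_le_norm _).trans ((norm_add_le _ _).trans ?_))
      exact add_le_add (norm_inner_le_norm _ _) (norm_inner_le_norm _ _)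
    rw [hre] at h₂
    have h₃ : q.re ≤ C * (4 / t ^ 2) * N + Q / 4 := hq₁.trans hpert
    norm_num at h₁
    nlinarith

end Energy

/-! ### Stability of the combined system -/

section Main

variable {n p : ℕ} {ξ β : Fin n → ℝ} {K : Fin n → ℝ → ℝ} {ζ a b : Fin p → ℝ}

/-- The Hilbert space `L² ⊕ L²`. -/
abbrev PairState : Type := WithLp 2 (State × State)

/-- The isomorphism from the Hilbert space `L² ⊕ L²` onto the product with the supremum norm. -/
def pairEquiv : PairState ≃L[ℂ] State × State := WithLp.prodContinuousLinearEquiv 2 ℂ State State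

/-- The passage from the rod and the error to the rod and its estimate, `(z, e) ↦ (z, z - e)`. -/
def errEquiv : (State × State) ≃L[ℂ] State × State :=
  ContinuousLinearEquiv.equivOfInverse
    ((ContinuousLinearMap.fst ℂ State State).prod
      (ContinuousLinearMap.fst ℂ State State - ContinuousLinearMap.snd ℂ State State))
    ((ContinuousLinearMap.fst ℂ State State).prod
      (ContinuousLinearMap.fst ℂ State State - ContinuousLinearMap.snd ℂ State State))
    (fun w => by ext1 <;> simp) (fun w => by ext1 <;> simp)

lemma pullback_errEquiv :
    pullback errEquiv (lqgSystem ξ β K ζ a b) = lqgSystemErr ξ β K ζ a b := rfl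

/-- The combined system on the Hilbert space `L² ⊕ L²` is sectorial. -/
lemma exists_isSectorial (hξ : ∀ k, ξ k ∈ Icc (0 : ℝ) 1)
    (hK : ∀ k, ContinuousOn (K k) (Icc 0 1)) (hζ : ∀ i, ζ i ∈ Icc (0 : ℝ) 1) :
    ∃ ω, IsSectorial (pullback pairEquiv (lqgSystemErr ξ β K ζ a b)) ω := by
  obtain ⟨ω, hω, h⟩ := exists_garding (β := β) (a := a) (b := b) hξ hK hζ
  refine ⟨ω, hω, fun w v hwv => ?_, fun v hv => ?_, fun μ => ?_⟩
  · have := (h _ _ _ _ hwv).1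
    rw [WithLp.prod_norm_sq_eq_of_L2, WithLp.prod_inner_apply]
    exact this
  · have hv' : (((0 : State), (0 : State)), (v.fst, v.snd)) ∈ lqgSystemErr ξ β K ζ a b := hv
    rw [mem_lqgSystemErr_iff, mem_errorDynamics_iff hζ, mem_rod_iff hξ] at hv'
    obtain ⟨⟨E, hE, hE'⟩, Z, hZ, hZ'⟩ := hv'
    obtain ⟨L, hL⟩ := exists_feedbackCLM hK
    have hE0 : E = 0 := toState_injective (by rw [hE, map_zero])
    have hZ0 : Z = 0 := toState_injective (by rw [hZ, map_zero])
    subst hE0 hZ0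
    have hext : ∀ x : ℝ, ext 0 x = 0 := fun x => rfl
    have h₁ : v.fst = 0 := by
      refine IsSolution.eq_zero (η := ξ) ?_
      convert hZ' using 1
      ext k
      simp [← hL]
    have h₂ : v.snd = 0 := by
      refine IsSolution.eq_zero (η := ζ) ?_
      convert hE' using 1
      · ext i
        simp [hext]
      · simp [hext]
    exact pairEquiv.injective (Prod.ext h₁ h₂)
  · rcases lqgSystemErr_alternative (β := β) (a := a) (b := b) hξ hK hζ μ with
      ⟨⟨w, hw, h'⟩, -⟩ | ⟨⟨R, hRc, hR⟩, -⟩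
    · refine Or.inl ⟨pairEquiv.symm w, by simpa using hw, ?_⟩
      rw [mem_pullback, map_smul, pairEquiv.apply_symm_apply]
      exact h'
    · exact Or.inr ⟨_, (hRc.comp_clm (pairEquiv : PairState →L[ℂ] State × State)).clm_comp
        (pairEquiv.symm : State × State →L[ℂ] PairState), isResolvent_pullback_iff.2 hR⟩

/-- Stability.  Uniform convergence follows since the supremum norms of the profiles are controlled by
the state and its velocity, both of which tend to zero. -/
lemma stable_of_spec_neg (hξ : ∀ k, ξ k ∈ Icc (0 : ℝ) 1)
    (hK : ∀ k, ContinuousOn (K k) (Icc 0 1)) (hζ : ∀ i, ζ i ∈ Icc (0 : ℝ) 1)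
    (h₁ : ∀ μ ∈ spec (closedLoop ξ β K), μ.re < 0)
    (h₂ : ∀ μ ∈ spec (errorDynamics ζ a b), μ.re < 0) :
    AsymptoticallyStable (lqgSystem ξ β K ζ a b) ∧
    ∀ u, IsTrajectory (lqgSystem ξ β K ζ a b) u → ∀ Z E : ℝ → ℝ → ℂ,
      (∀ t > 0, Represents (Z t) (u t).1 ∧ Represents (E t) ((u t).1 - (u t).2)) →
      TendstoUniformlyOn Z 0 atTop (Icc 0 1) ∧ TendstoUniformlyOn E 0 atTop (Icc 0 1) := by
  obtain ⟨ω, hsec⟩ := exists_isSectorial (β := β) (a := a) (b := b) hξ hK hζ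
  have hneg : ∀ (μ : ℂ) (w : PairState), w ≠ 0 →
      (w, μ • w) ∈ pullback pairEquiv (lqgSystemErr ξ β K ζ a b) → μ.re < 0 := by
    intro μ w hw hwG
    have := mem_spec_of_eigenvector hw hwG
    rw [spec_pullback, spec_lqgSystemErr hξ hK hζ] at this
    exact this.elim (h₁ μ) (h₂ μ)
  obtain ⟨hst, hvel⟩ := hsec.asymptoticallyStable hneg
  rw [← pullback_errEquiv] at hst hvel
  refine ⟨hst.of_pullback.of_pullback, fun u hu Z E hZE => ?_⟩
  set w : ℝ → PairState := fun t => pairEquiv.symm (errEquiv.symm (u t)) with hw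
  have hwt : IsTrajectory (pullback pairEquiv (pullback errEquiv (lqgSystem ξ β K ζ a b))) w :=
    hu.symm_comp.symm_comp
  obtain ⟨ω', hω', hg⟩ := exists_garding (β := β) (a := a) (b := b) hξ hK hζ
  have hlim : ∀ l : PairState →L[ℂ] State, Tendsto (fun t => ‖l (w t)‖) atTop (𝓝 0) ∧
      Tendsto (fun t => ‖l (deriv w t)‖) atTop (𝓝 0) := fun l => by
    have h₃ := ((l.continuous.tendsto 0).comp (hst.2.2 w hwt)).norm
    have h₄ := ((l.continuous.tendsto 0).comp (hvel w hwt)).norm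
    rw [map_zero, norm_zero] at h₃ h₄
    exact ⟨h₃, h₄⟩
  obtain ⟨hz, hf⟩ := hlim (ContinuousLinearMap.fst ℂ State State ∘L
    (pairEquiv : PairState →L[ℂ] State × State))
  obtain ⟨he, hv⟩ := hlim (ContinuousLinearMap.snd ℂ State State ∘L
    (pairEquiv : PairState →L[ℂ] State × State))
  have hbound : Tendsto (fun t => ω' * (‖(w t).fst‖ ^ 2 + ‖(w t).snd‖ ^ 2) +
      8 * (‖(w t).fst‖ * ‖(deriv w t).fst‖ + ‖(w t).snd‖ * ‖(deriv w t).snd‖)) atTop (𝓝 0) := by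
    have := (((hz.pow 2).add (he.pow 2)).const_mul ω').add (((hz.mul hf).add (he.mul hv)).const_mul 8)
    have h0 : ω' * ((0 : ℝ) ^ 2 + 0 ^ 2) + 8 * (0 * 0 + 0 * 0) = 0 := by ring
    rw [h0] at this
    exact this
  have key : ∀ ε > 0, ∀ᶠ t in atTop, ∀ x ∈ Icc (0 : ℝ) 1, ‖Z t x‖ < ε ∧ ‖E t x‖ < ε := by
    intro ε hε
    filter_upwards [hbound.eventually_lt_const (show 0 < ε ^ 2 by positivity),
      eventually_gt_atTop 0] with t ht ht0 x hx
    obtain ⟨W, W', hW, hW', hle⟩ := (hg _ _ _ _ (hwt.deriv_mem ht0).2).2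
    have hlt : ‖W‖ + ‖W'‖ < ε := lt_of_pow_lt_pow_left₀ 2 hε.le (hle.trans_lt ht)
    obtain ⟨hZt, hEt⟩ := hZE t ht0
    have h₃ : toState W = (u t).1 := hW
    have h₄ : toState W' = (u t).1 - (u t).2 := hW'
    have h₅ := hZt.eqOn (h₃ ▸ represents_ext W) hx
    have h₆ := hEt.eqOn (h₄ ▸ represents_ext W') hx
    rw [h₅, h₆]
    have h₇ := norm_ext_le W x
    have h₈ := norm_ext_le W' x
    constructor <;> linarith [norm_nonneg W, norm_nonneg W']
  constructor
  · rw [Metric.tendstoUniformlyOn_iff]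
    intro ε hε
    filter_upwards [key ε hε] with t ht x hx
    rw [Pi.zero_apply, dist_zero_left]
    exact (ht x hx).1
  · rw [Metric.tendstoUniformlyOn_iff]
    intro ε hε
    filter_upwards [key ε hε] with t ht x hx
    rw [Pi.zero_apply, dist_zero_left]
    exact (ht x hx).2

theorem separationProperty (hξ : ∀ k, ξ k ∈ Icc (0 : ℝ) 1)
    (hK : ∀ k, ContinuousOn (K k) (Icc 0 1)) (hζ : ∀ i, ζ i ∈ Icc (0 : ℝ) 1) :
    SeparationProperty ξ β K ζ a b where
  triangular := mem_lqgSystemErr_iff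
  zero_error z f := by
    rw [mem_lqgSystemErr_iff, sub_zero]
    exact ⟨fun h => h.2, fun h => ⟨zero_mem_errorDynamics hζ, h⟩⟩
  spec_eq := by
    rw [← spec_lqgSystemErr hξ hK hζ, ← pullback_errEquiv, spec_pullback]
  spec_err_eq := spec_lqgSystemErr hξ hK hζ
  stable := stable_of_spec_neg hξ hK hζ

end Main

/-! ### Continuity of the linear-quadratic feedback gain -/

lemma abs_neg_add_sqrt_le {s d : ℝ} (hs : 0 < s) : |-s + √(s ^ 2 + d)| ≤ |d| / s := by
  rw [le_div_iff₀ hs]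
  rcases le_or_gt 0 (s ^ 2 + d) with h | h
  · have h₁ := Real.sq_sqrt h
    have h₂ := Real.sqrt_nonneg (s ^ 2 + d)
    have h₃ : d = (-s + √(s ^ 2 + d)) * (s + √(s ^ 2 + d)) := by linear_combination -h₁
    conv_rhs => rw [h₃, abs_mul, abs_of_nonneg (a := s + √(s ^ 2 + d)) (by positivity)]
    gcongr
    linarith
  · rw [Real.sqrt_eq_zero_of_nonpos h.le, add_zero, abs_neg, abs_of_pos hs]
    nlinarith [neg_le_abs d]

lemma exists_gammaCoeff_le {n : ℕ} (ξ β : Fin n → ℝ) (R : Matrix (Fin n) (Fin n) ℝ) :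
    ∃ M, ∀ j, |gammaCoeff ξ β R j| ≤ M := by
  refine ⟨∑ k, ∑ l, |β k| * |R⁻¹ k l| * |β l|, fun j => ?_⟩
  refine (Finset.abs_sum_le_sum_abs _ _).trans (Finset.sum_le_sum fun k _ => ?_)
  refine (Finset.abs_sum_le_sum_abs _ _).trans (Finset.sum_le_sum fun l _ => ?_)
  have hcos : ∀ i, |β i * Real.cos (j * Real.pi * ξ i)| ≤ |β i| := fun i => by
    rw [abs_mul]
    exact mul_le_of_le_one_right (abs_nonneg _) (Real.abs_cos_le_one _)
  rw [abs_mul, abs_mul]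
  exact mul_le_mul (mul_le_mul_of_nonneg_right (hcos k) (abs_nonneg _)) (hcos l) (abs_nonneg _)
    (by positivity)

lemma continuous_riccatiKernel {n : ℕ} (ξ β : Fin n → ℝ) (R : Matrix (Fin n) (Fin n) ℝ)
    (q x₁ : ℝ) : Continuous (riccatiKernel ξ β R q x₁) := by
  obtain ⟨M, hM⟩ := exists_gammaCoeff_le ξ β R
  have hM0 : 0 ≤ M := (abs_nonneg _).trans (hM 0)
  have hcoeff : ∀ j : ℕ, |riccatiCoeff ξ β R q j| ≤
      (if j = 0 then |riccatiCoeff ξ β R q 0| else 0) + M * |q| * (1 / (j : ℝ) ^ 2) := by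
    intro j
    rcases Nat.eq_zero_or_pos j with rfl | hj
    · simp
    · have hj' : (1 : ℝ) ≤ j := by exact_mod_cast hj
      rw [if_neg hj.ne', zero_add]
      have hpi : (1 : ℝ) ≤ Real.pi ^ 2 := one_le_pow₀ (by linarith [Real.pi_gt_three])
      have h₁ := abs_neg_add_sqrt_le (s := (j : ℝ) ^ 2 * Real.pi ^ 2) (d := gammaCoeff ξ β R j * q)
        (by positivity)
      have h₂ : ((j : ℝ) ^ 2 * Real.pi ^ 2) ^ 2 = (j : ℝ) ^ 4 * Real.pi ^ 4 := by ring
      rw [h₂] at h₁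
      refine h₁.trans ?_
      rw [mul_one_div, abs_mul]
      refine div_le_div₀ (by positivity) (by gcongr; exact hM j) (by positivity) ?_
      exact le_mul_of_one_le_right (by positivity) hpi
  refine continuous_tsum (u := fun j : ℕ => (if j = 0 then |riccatiCoeff ξ β R q 0| else 0) +
    M * |q| * (1 / (j : ℝ) ^ 2)) (fun j => by fun_prop) ?_ fun j x => ?_
  · refine Summable.add ?_ ((Real.summable_one_div_nat_pow.2 one_lt_two).mul_left _)
    exact summable_of_ne_finset_zero (s := {0}) fun j hj => if_neg (by simpa using hj)
  · rw [Real.norm_eq_abs, abs_mul, abs_mul]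
    refine le_trans ?_ (hcoeff j)
    refine (mul_le_of_le_one_right (by positivity) (Real.abs_cos_le_one _)).trans ?_
    exact mul_le_of_le_one_right (abs_nonneg _) (Real.abs_cos_le_one _)

lemma continuous_lqrGain {n : ℕ} (ξ β : Fin n → ℝ) (R : Matrix (Fin n) (Fin n) ℝ) (q : ℝ)
    (k : Fin n) : Continuous (lqrGain ξ β R q k) := by
  have := fun l => continuous_riccatiKernel ξ β R q (ξ l)
  unfold lqrGain
  fun_prop

end HeatRod
end

theorem mainTheorem6 {m p : ℕ}
    (ξ β : Fin (m + 2) → ℝ) (hξ : StrictMono ξ) (hξ0 : ξ 0 = 0) (hξ1 : ξ (Fin.last (m + 1)) = 1)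
    (hβ : ∀ k, 0 ≤ β k)
    (ζ : Fin p → ℝ) (hζ : StrictMono ζ) (hζ01 : ∀ i, ζ i ∈ Set.Icc (0 : ℝ) 1)
    (R : Matrix (Fin (m + 2)) (Fin (m + 2)) ℝ) (hR : R.PosDef) (q : ℝ) (hq : 0 < q)
    (B : ℝ) (C D : Fin p → ℝ) (hC : ∀ i, 0 < C i) (hD : ∀ i, D i ≠ 0) :
    (∀ K : Fin (m + 2) → ℝ → ℝ, (∀ k, ContinuousOn (K k) (Set.Icc 0 1)) →
      ∀ a b : Fin p → ℝ, HeatRod.SeparationProperty ξ β K ζ a b) ∧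
    HeatRod.SeparationProperty ξ β (HeatRod.lqrGain ξ β R q) ζ (HeatRod.kalmanGain B C D) 0 ∧
    HeatRod.SeparationProperty ξ β (HeatRod.lqrGain ξ β R q) ζ 0 (HeatRod.kalmanGain B C D) := by
  have hξ01 : ∀ k, ξ k ∈ Set.Icc (0 : ℝ) 1 := fun k =>
    ⟨hξ0 ▸ hξ.monotone (Fin.zero_le k), hξ1 ▸ hξ.monotone (Fin.le_last k)⟩
  have hgain : ∀ k, ContinuousOn (HeatRod.lqrGain ξ β R q k) (Set.Icc 0 1) := fun k =>
    (HeatRod.continuous_lqrGain ξ β R q k).continuousOn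
  exact ⟨fun K hK a b => HeatRod.separationProperty hξ01 hK hζ01,
    HeatRod.separationProperty hξ01 hgain hζ01, HeatRod.separationProperty hξ01 hgain hζ01⟩
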